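/- Let $p\ge 2$ and $\beta>2$ be real numbers and $L>0$. Let $m$ be the largest integer strictly smaller than $\beta$, and let $\Sigma(\beta,L)$ be the set of probability densities $f$ on $[0,1]$ that are $m$ times differentiable on $[0,1]$ and satisfy $|f^{(m)}(x)-f^{(m)}(y)|\le L|x-y|^{\beta-m}$ for all $x,y\in[0,1]$. Let $X_1,\dots,X_n$ be i.i.d. with density $f$, and let $E_f^n$ be the expectation under their law. For an estimator $\tilde f_n$ (a measurable function of $X_1,\dots,X_n$ and of $t\in[0,1]$) put $$R_n(\tilde f_n,\beta,L)=\sup_{f\in\Sigma(\beta,L)}\Bigl(E_f^n\int_0^1|\tilde f_n(t)-f(t)|^p\,dt\Bigr)^{1/p},\qquad r_n(\beta,L)=\inf_{\tilde f_n}R_n(\tilde f_n,\beta,L),$$ where the infimum is over all estimators based on $X_1,\dots,X_n$. For $b\in(0,1)$ the beta kernel estimator is $$\hat f_b(t)=\frac1n\sum_{k=1}^nK_{t,b}(X_k),\qquad K_{t,b}(x)=\frac{x^{t/b}(1-x)^{(1-t)/b}}{B\left(\frac tb+1,\frac{1-t}b+1\right)}\,\mathbf 1_{[0,1]}(x),\qquad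 t\in[0,1],$$ where $B$ is the Euler beta function. Then there is a constant $c>0$ (not depending on $n$ or $b$) such that $$R_n(\hat f_b,\beta,L)\ge c\,n^{-2/5}\qquad\text{for all }n\ge1\text{ and all }b\in(0,1),$$ and, for every sequence $(b_n)$ in $(0,1)$, $$\liminf_{n\to\infty}\frac{R_n(\hat f_{b_n},\beta,L)}{r_n(\beta,L)}=\infty .$$ In particular, no beta kernel estimator is minimax up to a constant on $\Sigma(\beta,L)$. -/

import Mathlib

open MeasureTheory Set Filter
open scoped ENNReal

noncomputable section

namespace BetaKernel

/-- The largest natural number strictly smaller than `β` (for `β > 0`). -/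
def order (β : ℝ) : ℕ := ⌈β⌉₊ - 1

theorem order_isGreatest {β : ℝ} (hβ : 0 < β) :
    IsGreatest {l : ℕ | (l : ℝ) < β} (order β) := by
  have h1 : 0 < ⌈β⌉₊ := Nat.ceil_pos.mpr hβ
  refine ⟨?_, fun l hl => ?_⟩
  · have h2 : order β < ⌈β⌉₊ := by
      unfold order
      omega
    exact Nat.lt_ceil.mp h2
  · have h2 : l < ⌈β⌉₊ := Nat.lt_ceil.mpr hl
    unfold order
    omega

/-- `f`, seen as a function on `[0,1]`, is a probability density. -/
def IsDensity (f : ℝ → ℝ) : Prop :=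
  (∀ x ∈ Icc (0 : ℝ) 1, 0 ≤ f x) ∧ IntegrableOn f (Icc 0 1) ∧ ∫ x in Icc (0 : ℝ) 1, f x = 1

/-- The class `Σ(β, L)`: densities on `[0,1]` that are `m` times differentiable on `[0,1]`
(one-sided at the endpoints) and whose `m`-th derivative is `(β - m)`-Hölder with constant `L`,
where `m` is the largest integer `< β`. Only the values of `f` on `[0,1]` matter. -/
def holderClass (β L : ℝ) : Set (ℝ → ℝ) :=
  {f | IsDensity f ∧
    (∀ k < order β,
      DifferentiableOn ℝ (iteratedDerivWithin k f (Icc 0 1)) (Icc 0 1)) ∧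
    ∀ x ∈ Icc (0 : ℝ) 1, ∀ y ∈ Icc (0 : ℝ) 1,
      |iteratedDerivWithin (order β) f (Icc 0 1) x
        - iteratedDerivWithin (order β) f (Icc 0 1) y|
      ≤ L * |x - y| ^ (β - (order β : ℝ))}

/-- The law on `[0,1]` (as a measure on `ℝ`) with Lebesgue density `f`. -/
def law (f : ℝ → ℝ) : Measure ℝ :=
  (volume.restrict (Icc 0 1)).withDensity fun x => ENNReal.ofReal (f x)

/-- The law of an i.i.d. sample `(X₁, …, Xₙ)` with density `f`. -/
def sampleLaw (n : ℕ) (f : ℝ → ℝ) : Measure (Fin n → ℝ) :=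
  Measure.pi fun _ => law f

/-- An estimator: a function of the sample and of the point `t`, jointly measurable. -/
def IsEstimator {n : ℕ} (T : (Fin n → ℝ) → ℝ → ℝ) : Prop :=
  Measurable (Function.uncurry T)

/-- The pointwise risk `(E_f^n ‖T - f‖_p^p)^{1/p}`, with the `L^p` norm on `[0,1]`. -/
def risk (p : ℝ) {n : ℕ} (T : (Fin n → ℝ) → ℝ → ℝ) (f : ℝ → ℝ) : ℝ≥0∞ :=
  (∫⁻ X, ∫⁻ t in Icc (0 : ℝ) 1, ‖T X t - f t‖ₑ ^ p ∂volume ∂(sampleLaw n f)) ^ (1 / p)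

/-- The maximal risk over `Σ(β, L)`. -/
def maxRisk (p β L : ℝ) {n : ℕ} (T : (Fin n → ℝ) → ℝ → ℝ) : ℝ≥0∞ :=
  ⨆ f ∈ holderClass β L, risk p T f

/-- The minimax risk: infimum of the maximal risk over all estimators from `n` observations. -/
def minimaxRisk (p β L : ℝ) (n : ℕ) : ℝ≥0∞ :=
  ⨅ (T : (Fin n → ℝ) → ℝ → ℝ) (_ : IsEstimator T), maxRisk p β L T

/-- The beta kernel `K_{t,b}`. -/
def betaKernel (b t x : ℝ) : ℝ :=
  (Icc (0 : ℝ) 1).indicator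
    (fun x => x ^ (t / b) * (1 - x) ^ ((1 - t) / b)
      / ProbabilityTheory.beta (t / b + 1) ((1 - t) / b + 1)) x

/-- The beta kernel estimator with bandwidth `b`, built on the sample `X`. -/
def betaEstimator (n : ℕ) (b : ℝ) (X : Fin n → ℝ) (t : ℝ) : ℝ :=
  (1 / (n : ℝ)) * ∑ k, betaKernel b t (X k)

end BetaKernel

end

/-!
The beta kernel estimator has a bias of order `b` that no smoothness of the density beyond two
derivatives can reduce, and a standard deviation of order `n ^ (-1/2) * b ^ (-1/4)`. The larger of
the two is at least of order `n ^ (-2/5)` for every bandwidth, whereas the minimax risk on the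
Hölder class is `O (n ^ (-β / (2 * β + 1)))`, which is `o (n ^ (-2/5))` as soon as `β > 2`.

*Lower bound* (`le_maxRisk_betaEstimator`). All `L^p` risks with `p ≥ 2` dominate the `L^1` and
`L^2` risks, since the underlying measure is a probability measure. For the density `1/2 + x`,
whose higher derivatives vanish, the expectation of the estimator is an explicit beta mean, and the
bias is `-b (2t - 1) / (1 + 2b)` (`bias_le_maxRisk`). For the uniform density the variance at `t` is
`(∫ K_{t,b}² - 1) / n`, and a probability density of variance at most `b / 4` has squared `L²` norm
at least `9 / (32 √b)` (`le_integral_betaKernel_sq`, `variance_le_maxRisk`).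

*Upper bound* (`exists_minimaxRisk_le`). On each of `N` equal cells the density is estimated by
means of a bounded kernel reproducing the polynomials of degree at most `order β`
(`exists_reproducing_kernel`), which also avoids boundary effects. Taylor's formula bounds the bias
by a multiple of `N ^ (-β)`, and, with `N = 1`, bounds the densities of the class uniformly.
This makes the kernel variance `O (N)`, and an exponential moment bound
(`lintegral_exp_sum_le`) converts it into a `p`-th moment of order `√(N / n) ^ p` for every real `p ≥ 1`.
The choice `N ≈ n ^ (1 / (2 * β + 1))` balances both terms.
-/

namespace BetaKernel

/-! ### Local polynomial approximation and reproducing kernels -/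

/-- Taylor's formula at `t` for a function with Hölder `m`-th derivative. The constant is not
optimal: integrating the bound for the derivative by the mean value inequality, rather than
exactly, loses the factorial. -/
theorem abs_sub_taylor_le {L α t : ℝ} (hα : 0 ≤ α) (hL : 0 ≤ L)
    (ht : t ∈ Icc (0 : ℝ) 1) (m : ℕ) (f : ℝ → ℝ)
    (hd : ∀ k < m, DifferentiableOn ℝ (iteratedDerivWithin k f (Icc 0 1)) (Icc 0 1))
    (hm : ∀ x ∈ Icc (0 : ℝ) 1, |iteratedDerivWithin m f (Icc 0 1) x
      - iteratedDerivWithin m f (Icc 0 1) t| ≤ L * |x - t| ^ α) :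
    ∃ c : ℕ → ℝ, c 0 = f t ∧ ∀ x ∈ Icc (0 : ℝ) 1,
      |f x - ∑ k ∈ Finset.range (m + 1), c k * (x - t) ^ k| ≤ L * |x - t| ^ (m + α) := by
  induction m generalizing f with
  | zero =>
    refine ⟨fun _ => f t, rfl, fun x hx => ?_⟩
    simpa using hm x hx
  | succ m ih =>
    have hI : UniqueDiffOn ℝ (Icc (0 : ℝ) 1) := uniqueDiffOn_Icc zero_lt_one
    have hf : DifferentiableOn ℝ f (Icc 0 1) := by simpa using hd 0 (Nat.succ_pos m)
    obtain ⟨c, hc0, hc⟩ := ih (derivWithin f (Icc 0 1))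
      (fun k hk => (hd (k + 1) (by omega)).congr fun x hx => by
        rw [iteratedDerivWithin_succ'])
      (fun x hx => by
        have := hm x hx
        rwa [iteratedDerivWithin_succ'] at this)
    refine ⟨fun k => if k = 0 then f t else c (k - 1) / k, by simp, fun x hx => ?_⟩
    set g : ℝ → ℝ := fun y => f y - ∑ k ∈ Finset.range (m + 1), c k / (k + 1) * (y - t) ^ (k + 1)
      with hg
    have hgx : f x - ∑ k ∈ Finset.range (m + 1 + 1),
        (if k = 0 then f t else c (k - 1) / k) * (x - t) ^ k = g x - g t := by
      rw [Finset.sum_range_succ']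
      simp [hg]
      ring
    have hsub : uIcc t x ⊆ Icc (0 : ℝ) 1 := ordConnected_Icc.uIcc_subset ht hx
    have hder : ∀ y ∈ uIcc t x, HasDerivWithinAt g
        (derivWithin f (Icc 0 1) y - ∑ k ∈ Finset.range (m + 1), c k * (y - t) ^ k)
        (uIcc t x) y := by
      intro y hy
      refine HasDerivWithinAt.sub
        (((hf y (hsub hy)).hasDerivWithinAt).mono hsub) ?_
      refine HasDerivWithinAt.fun_sum fun k _ => ?_
      have h1 : HasDerivAt (fun y : ℝ => c k / (k + 1) * (y - t) ^ (k + 1))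
          (c k / (k + 1) * (((k + 1 : ℕ) : ℝ) * (y - t) ^ k * 1)) y :=
        (((hasDerivAt_id y).sub_const t).pow (k + 1)).const_mul _
      have h2 : c k / (k + 1) * (((k + 1 : ℕ) : ℝ) * (y - t) ^ k * 1) = c k * (y - t) ^ k := by
        have : (k : ℝ) + 1 ≠ 0 := by positivity
        push_cast
        field_simp
      rw [h2] at h1
      exact h1.hasDerivWithinAt
    have hb : ∀ y ∈ uIcc t x,
        ‖derivWithin f (Icc 0 1) y - ∑ k ∈ Finset.range (m + 1), c k * (y - t) ^ k‖
          ≤ L * |x - t| ^ (m + α) := by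
      intro y hy
      exact (hc y (hsub hy)).trans (mul_le_mul_of_nonneg_left
        (Real.rpow_le_rpow (abs_nonneg _) (abs_sub_left_of_mem_uIcc hy) (by positivity)) hL)
    have := (convex_uIcc t x).norm_image_sub_le_of_norm_hasDerivWithin_le hder hb
      left_mem_uIcc right_mem_uIcc
    rw [hgx]
    refine this.trans (le_of_eq ?_)
    rw [Real.norm_eq_abs, mul_assoc]
    congr 1
    push_cast
    rw [show (m : ℝ) + 1 + α = (m + α) + 1 by ring,
      Real.rpow_add_one' (abs_nonneg _) (by positivity)]

open Polynomial in
/-- A density of the Hölder class is approximated at every point `t` by a polynomial of degree at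
most `order β`, namely its Taylor polynomial, up to an error `L * |x - t| ^ β`. -/
theorem exists_polynomial_of_mem_holderClass {β L : ℝ} (hβ : 0 < β) (hL : 0 ≤ L) {f : ℝ → ℝ}
    (hf : f ∈ holderClass β L) {t : ℝ} (ht : t ∈ Icc (0 : ℝ) 1) :
    ∃ P : ℝ[X], P.natDegree ≤ order β ∧ P.eval t = f t ∧
      ∀ x ∈ Icc (0 : ℝ) 1, |f x - P.eval x| ≤ L * |x - t| ^ β := by
  have hlt : (order β : ℝ) < β := (order_isGreatest hβ).1
  obtain ⟨c, hc0, hc⟩ := abs_sub_taylor_le (sub_nonneg.2 hlt.le) hL ht (order β) f hf.2.1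
    (fun x hx => hf.2.2 x hx t ht)
  refine ⟨∑ k ∈ Finset.range (order β + 1), C (c k) * (X - C t) ^ k, ?_, ?_, fun x hx => ?_⟩
  · refine natDegree_sum_le_of_forall_le _ _ fun k hk => ?_
    refine (natDegree_C_mul_le _ _).trans ?_
    refine (natDegree_pow_le).trans ?_
    rw [natDegree_X_sub_C]
    have := Finset.mem_range.1 hk
    omega
  · simp [eval_finsetSum, Finset.sum_range_succ', hc0]
  · have := hc x hx
    rw [add_sub_cancel] at this
    simpa [eval_finsetSum] using this

open Polynomial in
/-- The `i`-th coefficient, as a functional on polynomials of degree at most `m`, is represented by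
a polynomial through the inner product of `L²([0,1])`: that inner product is positive definite on
polynomials, so it identifies the finite-dimensional space with its dual. -/
theorem exists_dual_polynomial (m i : ℕ) :
    ∃ ψ : ℝ[X], ∀ P : ℝ[X], P.natDegree ≤ m →
      ∫ v in (0 : ℝ)..1, ψ.eval v * P.eval v = P.coeff i := by
  have hint : ∀ P Q : ℝ[X], IntervalIntegrable (fun v => Q.eval v * P.eval v) volume 0 1 :=
    fun P Q => (Q.continuous.mul P.continuous).intervalIntegrable _ _
  let Φ : degreeLT ℝ (m + 1) →ₗ[ℝ] Module.Dual ℝ (degreeLT ℝ (m + 1)) :=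
    LinearMap.mk₂ ℝ (fun Q P => ∫ v in (0 : ℝ)..1, (Q : ℝ[X]).eval v * (P : ℝ[X]).eval v)
      (fun Q Q' P => by
        simp only [Submodule.coe_add, eval_add, add_mul]
        exact intervalIntegral.integral_add (hint _ _) (hint _ _))
      (fun a Q P => by
        simp only [Submodule.coe_smul, eval_smul, smul_eq_mul, mul_assoc]
        exact intervalIntegral.integral_const_mul _ _)
      (fun Q P P' => by
        simp only [Submodule.coe_add, eval_add, mul_add]
        exact intervalIntegral.integral_add (hint _ _) (hint _ _))
      (fun a Q P => by
        simp only [Submodule.coe_smul, eval_smul, smul_eq_mul, mul_left_comm _ a]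
        exact intervalIntegral.integral_const_mul _ _)
  have hinj : Function.Injective Φ := by
    rw [injective_iff_map_eq_zero]
    intro Q hQ
    have h0 : ∫ v in (0 : ℝ)..1, (Q : ℝ[X]).eval v * (Q : ℝ[X]).eval v = 0 :=
      congrArg (fun g => g Q) hQ
    by_contra hne
    have hne' : (Q : ℝ[X]) ≠ 0 := fun h => hne (Subtype.ext h)
    have hinf : (Ioc (0 : ℝ) 1 \ {v | (Q : ℝ[X]).IsRoot v}).Nonempty :=
      ((Ioc_infinite zero_lt_one).sdiff (Polynomial.finite_setOfPred_isRoot hne')).nonempty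
    obtain ⟨v, hv, hv'⟩ := hinf
    have hpos : 0 < ∫ v in (0 : ℝ)..1, (Q : ℝ[X]).eval v * (Q : ℝ[X]).eval v := by
      refine intervalIntegral.integral_pos zero_lt_one
        ((Q : ℝ[X]).continuous.mul (Q : ℝ[X]).continuous).continuousOn
        (fun x _ => mul_self_nonneg _) ⟨v, Ioc_subset_Icc_self hv, ?_⟩
      exact mul_self_pos.2 hv'
    exact hpos.ne' h0
  have hsurj : Function.Surjective Φ :=
    (LinearMap.injective_iff_surjective_of_finrank_eq_finrank
      (Subspace.dual_finrank_eq).symm).1 hinj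
  obtain ⟨ψ, hψ⟩ := hsurj ((lcoeff ℝ i).comp (degreeLT ℝ (m + 1)).subtype)
  refine ⟨ψ, fun P hP => ?_⟩
  have hmem : P ∈ degreeLT ℝ (m + 1) := by
    rw [mem_degreeLT]
    exact (degree_le_of_natDegree_le hP).trans_lt (by exact_mod_cast Nat.lt_succ_self m)
  exact congrArg (fun g => g ⟨P, hmem⟩) hψ

open Polynomial in
/-- A continuous kernel on the unit square that reproduces the polynomials of degree at most `m`:
`K u v = ∑ i ≤ m, u ^ i * ψ i v`, where `ψ i` represents the `i`-th coefficient. -/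
theorem exists_reproducing_kernel (m : ℕ) :
    ∃ (K : ℝ → ℝ → ℝ) (A : ℝ), Continuous (Function.uncurry K) ∧ 1 ≤ A ∧
      (∀ u ∈ Icc (0 : ℝ) 1, ∀ v ∈ Icc (0 : ℝ) 1, |K u v| ≤ A) ∧
      ∀ (P : ℝ[X]), P.natDegree ≤ m → ∀ u,
        ∫ v in (0 : ℝ)..1, K u v * P.eval v = P.eval u := by
  choose ψ hψ using exists_dual_polynomial m
  let K : ℝ → ℝ → ℝ := fun u v => ∑ i ∈ Finset.range (m + 1), u ^ i * (ψ i).eval v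
  have hK : Continuous (Function.uncurry K) := by
    refine continuous_finsetSum _ fun i _ => ?_
    exact (continuous_fst.pow i).mul ((ψ i).continuous.comp continuous_snd)
  obtain ⟨A, hA⟩ := ((isCompact_Icc (a := (0 : ℝ)) (b := 1)).prod
    (isCompact_Icc (a := (0 : ℝ)) (b := 1))).exists_bound_of_continuousOn hK.continuousOn
  refine ⟨K, max A 1, hK, le_max_right _ _, fun u hu v hv => ?_, fun P hP u => ?_⟩
  · exact (hA (u, v) ⟨hu, hv⟩).trans (le_max_left _ _)
  · have h1 : ∀ v, K u v * P.eval v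
        = ∑ i ∈ Finset.range (m + 1), u ^ i * ((ψ i).eval v * P.eval v) := fun v => by
      rw [Finset.sum_mul]
      exact Finset.sum_congr rfl fun i _ => mul_assoc _ _ _
    simp_rw [h1]
    rw [intervalIntegral.integral_finsetSum]
    · simp_rw [intervalIntegral.integral_const_mul, hψ _ P hP]
      rw [eval_eq_sum_range' (Nat.lt_succ_of_le hP)]
      exact Finset.sum_congr rfl fun i _ => mul_comm _ _
    · intro i _
      exact (continuous_const.mul
        ((ψ i).continuous.mul P.continuous)).intervalIntegrable _ _

/-! ### Moments of sums of bounded i.i.d. variables -/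

theorem isProbabilityMeasure_law {f : ℝ → ℝ} (hf : IsDensity f) :
    IsProbabilityMeasure (law f) := by
  refine ⟨?_⟩
  rw [law, withDensity_apply _ MeasurableSet.univ, Measure.restrict_univ,
    ← ofReal_integral_eq_lintegral_ofReal hf.2.1
      ((ae_restrict_iff' measurableSet_Icc).2 (ae_of_all _ hf.1)), hf.2.2, ENNReal.ofReal_one]

theorem integral_law {f : ℝ → ℝ} (hf : IsDensity f) (g : ℝ → ℝ) :
    ∫ x, g x ∂(law f) = ∫ x in Icc (0 : ℝ) 1, g x * f x := by
  rw [law, integral_withDensity_eq_integral_toReal_smul₀ hf.2.1.aemeasurable.ennreal_ofReal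
    (ae_of_all _ fun _ => ENNReal.ofReal_lt_top)]
  refine setIntegral_congr_fun measurableSet_Icc fun x hx => ?_
  simp [ENNReal.toReal_ofReal (hf.1 x hx), mul_comm]

section Moments

variable {Ω : Type*} [MeasurableSpace Ω] {μ : Measure Ω} [IsProbabilityMeasure μ]
  {g : Ω → ℝ} {M v : ℝ}

/-- Bernstein's bound on the moment generating function of a centred bounded variable, from
`exp y ≤ 1 + y + y ^ 2` for `|y| ≤ 1`. -/
theorem integral_exp_mul_sub_integral_le (hg : Measurable g) (hM : ∀ x, |g x| ≤ M)
    (hv : ∫ x, g x ^ 2 ∂μ ≤ v) {s : ℝ} (hs : |s| * (2 * M) ≤ 1) :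
    ∫ x, Real.exp (s * (g x - ∫ y, g y ∂μ)) ∂μ ≤ Real.exp (s ^ 2 * v) := by
  set m := ∫ y, g y ∂μ with hm
  have hgi : Integrable g μ := Integrable.of_bound hg.aestronglyMeasurable M (ae_of_all _ hM)
  have hg2 : Integrable (fun x => g x ^ 2) μ :=
    Integrable.of_bound (hg.pow_const 2).aestronglyMeasurable (M ^ 2) (ae_of_all _ fun x => by
      rw [Real.norm_eq_abs, abs_pow]
      exact pow_le_pow_left₀ (abs_nonneg _) (hM x) 2)
  have hmM : |m| ≤ M := by
    have := norm_integral_le_of_norm_le_const (μ := μ) (f := g) (ae_of_all _ hM)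
    simpa using this
  have hsmall : ∀ x, |s * (g x - m)| ≤ 1 := fun x => by
    rw [abs_mul]
    refine le_trans (mul_le_mul_of_nonneg_left ?_ (abs_nonneg _)) hs
    have := abs_sub (g x) m
    linarith [hM x]
  have hexp : Integrable (fun x => Real.exp (s * (g x - m))) μ :=
    Integrable.of_bound (by fun_prop) (Real.exp 1) (ae_of_all _ fun x => by
      rw [Real.norm_eq_abs, Real.abs_exp]
      exact Real.exp_le_exp.2 ((le_abs_self _).trans (hsmall x)))
  have hr : Integrable (fun x => (1 - s * m + s ^ 2 * m ^ 2)
      + ((s - 2 * s ^ 2 * m) * g x + s ^ 2 * g x ^ 2)) μ :=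
    (integrable_const _).add ((hgi.const_mul _).add (hg2.const_mul _))
  calc ∫ x, Real.exp (s * (g x - m)) ∂μ
      ≤ ∫ x, ((1 - s * m + s ^ 2 * m ^ 2)
        + ((s - 2 * s ^ 2 * m) * g x + s ^ 2 * g x ^ 2)) ∂μ := by
        refine integral_mono hexp hr fun x => ?_
        have := (abs_le.1 (Real.abs_exp_sub_one_sub_id_le (hsmall x))).2
        have h2 : (s * (g x - m)) ^ 2
          = s ^ 2 * m ^ 2 - 2 * s ^ 2 * m * g x + s ^ 2 * g x ^ 2 := by ring
        simp only
        linarith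
    _ = 1 + s ^ 2 * (∫ x, g x ^ 2 ∂μ - m ^ 2) := by
        have h12 : Integrable (fun x => (s - 2 * s ^ 2 * m) * g x + s ^ 2 * g x ^ 2) μ :=
          (hgi.const_mul _).add (hg2.const_mul _)
        rw [integral_add (integrable_const _) h12, integral_add (hgi.const_mul _) (hg2.const_mul _),
          integral_const_mul,
          integral_const_mul, ← hm]
        simp
        ring
    _ ≤ s ^ 2 * v + 1 := by
        have : s ^ 2 * (∫ x, g x ^ 2 ∂μ - m ^ 2) ≤ s ^ 2 * v :=
          mul_le_mul_of_nonneg_left (by nlinarith [sq_nonneg m]) (sq_nonneg s)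
        linarith
    _ ≤ Real.exp (s ^ 2 * v) := Real.add_one_le_exp _

theorem lintegral_exp_sum_le (hg : Measurable g) (hM : ∀ x, |g x| ≤ M)
    (hv : ∫ x, g x ^ 2 ∂μ ≤ v) {s : ℝ} (hs : |s| * (2 * M) ≤ 1) {n : ℕ}
    (hn : n * (s ^ 2 * v) ≤ 1) :
    ∫⁻ X : Fin n → Ω, ENNReal.ofReal (Real.exp (s * ∑ k, (g (X k) - ∫ y, g y ∂μ)))
      ∂(Measure.pi fun _ => μ) ≤ ENNReal.ofReal (Real.exp 1) := by
  set m := ∫ y, g y ∂μ with hm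
  have hprod : ∀ X : Fin n → Ω, Real.exp (s * ∑ k, (g (X k) - m))
      = ∏ k, Real.exp (s * (g (X k) - m)) := fun X => by
    rw [Finset.mul_sum, Real.exp_sum]
  have hmM : |m| ≤ M := by
    have := norm_integral_le_of_norm_le_const (μ := μ) (f := g) (ae_of_all _ hM)
    simpa using this
  have hexp : Integrable (fun x => Real.exp (s * (g x - m))) μ :=
    Integrable.of_bound (by fun_prop) (Real.exp (|s| * (2 * M))) (ae_of_all _ fun x => by
      rw [Real.norm_eq_abs, Real.abs_exp]
      refine Real.exp_le_exp.2 ((le_abs_self _).trans ?_)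
      rw [abs_mul]
      refine mul_le_mul_of_nonneg_left ?_ (abs_nonneg _)
      have := abs_sub (g x) m
      linarith [hM x])
  simp_rw [hprod]
  rw [← ofReal_integral_eq_lintegral_ofReal (Integrable.fintype_prod fun _ => hexp)
    (ae_of_all _ fun X => Finset.prod_nonneg fun _ _ => (Real.exp_pos _).le)]
  refine ENNReal.ofReal_le_ofReal ?_
  rw [integral_fintype_prod_eq_pow (fun x => Real.exp (s * (g x - m))), Fintype.card_fin]
  calc _ ≤ Real.exp (s ^ 2 * v) ^ n :=
        pow_le_pow_left₀ (integral_nonneg fun _ => (Real.exp_pos _).le)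
          (integral_exp_mul_sub_integral_le hg hM hv hs) n
    _ = Real.exp (n * (s ^ 2 * v)) := (Real.exp_nat_mul _ n).symm
    _ ≤ Real.exp 1 := Real.exp_le_exp.2 hn

theorem abs_rpow_le_mul_exp {p : ℝ} (hp : 0 < p) (x : ℝ) :
    |x| ^ p ≤ p ^ p * (Real.exp x + Real.exp (-x)) := by
  have h1 : (|x| / p) ^ p ≤ Real.exp |x| := by
    calc (|x| / p) ^ p ≤ Real.exp (|x| / p) ^ p := by
          refine Real.rpow_le_rpow (by positivity) ?_ hp.le
          linarith [Real.add_one_le_exp (|x| / p)]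
      _ = Real.exp |x| := by rw [← Real.exp_mul, div_mul_cancel₀ _ hp.ne']
  rw [Real.div_rpow (abs_nonneg _) hp.le, div_le_iff₀ (Real.rpow_pos_of_pos hp _)] at h1
  rw [mul_comm] at h1
  exact h1.trans (mul_le_mul_of_nonneg_left (Real.exp_abs_le x) (by positivity))

/-- Moment bound for a centred i.i.d. sum. It is used with `s` of order `(n * v) ^ (-1/2)`, where it
says that the `p`-th moment is of the order it would have for a Gaussian variable of variance
`n * v`; the real power `p` is controlled by the exponentials of `s * ∑` and `-s * ∑`. -/
theorem lintegral_rpow_sum_sub_integral_le (hg : Measurable g) (hM : ∀ x, |g x| ≤ M)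
    (hv : ∫ x, g x ^ 2 ∂μ ≤ v) {s : ℝ} (hs0 : 0 < s) (hs : s * (2 * M) ≤ 1) {n : ℕ}
    (hn : n * (s ^ 2 * v) ≤ 1) {p : ℝ} (hp : 1 ≤ p) :
    ∫⁻ X : Fin n → Ω, ‖∑ k, (g (X k) - ∫ y, g y ∂μ)‖ₑ ^ p ∂(Measure.pi fun _ => μ)
      ≤ ENNReal.ofReal (2 * Real.exp 1 * p / s) ^ p := by
  have hp0 : 0 < p := by linarith
  set m := ∫ y, g y ∂μ with hm
  set c : ℝ := p ^ p * (s ^ p)⁻¹ with hc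
  have hc0 : 0 ≤ c := by positivity
  have hpt : ∀ X : Fin n → Ω, ‖∑ k, (g (X k) - m)‖ₑ ^ p
      ≤ ENNReal.ofReal c * (ENNReal.ofReal (Real.exp (s * ∑ k, (g (X k) - m)))
        + ENNReal.ofReal (Real.exp (-s * ∑ k, (g (X k) - m)))) := fun X => by
    set y := ∑ k, (g (X k) - m)
    rw [← ENNReal.ofReal_add (Real.exp_pos _).le (Real.exp_pos _).le, ← ENNReal.ofReal_mul hc0,
      Real.enorm_eq_ofReal_abs, ENNReal.ofReal_rpow_of_nonneg (abs_nonneg _) hp0.le]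
    refine ENNReal.ofReal_le_ofReal ?_
    have h := abs_rpow_le_mul_exp hp0 (s * y)
    rw [abs_mul, abs_of_pos hs0, Real.mul_rpow hs0.le (abs_nonneg _)] at h
    have hsp : 0 < s ^ p := Real.rpow_pos_of_pos hs0 p
    rw [hc, mul_right_comm, ← div_eq_mul_inv, le_div_iff₀ hsp, mul_comm, neg_mul]
    exact h
  refine (lintegral_mono hpt).trans ?_
  rw [lintegral_const_mul _ (by fun_prop), lintegral_add_left (by fun_prop)]
  have h1 := lintegral_exp_sum_le (μ := μ) hg hM hv (s := s) (by rwa [abs_of_pos hs0]) hn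
  have h2 := lintegral_exp_sum_le (μ := μ) hg hM hv (s := -s)
    (by rwa [abs_neg, abs_of_pos hs0]) (n := n) (by rwa [neg_sq])
  refine (mul_le_mul_right (add_le_add h1 h2) _).trans ?_
  have he : 1 ≤ Real.exp 1 := Real.one_le_exp zero_le_one
  rw [← ENNReal.ofReal_add (Real.exp_pos _).le (Real.exp_pos _).le, ← ENNReal.ofReal_mul hc0,
    ENNReal.ofReal_rpow_of_nonneg (by positivity) hp0.le]
  refine ENNReal.ofReal_le_ofReal ?_
  rw [Real.div_rpow (by positivity) hs0.le, Real.mul_rpow (by positivity) hp0.le, hc]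
  have h3 : 2 * Real.exp 1 ≤ (2 * Real.exp 1) ^ p :=
    Real.self_le_rpow_of_one_le (by linarith) hp
  have : p ^ p * (s ^ p)⁻¹ * (Real.exp 1 + Real.exp 1)
      = (2 * Real.exp 1) * p ^ p / s ^ p := by ring
  rw [this]
  gcongr

end Moments

/-! ### The cellwise polynomial kernel -/

/-- The kernel `K` transported to the cells `[i / N, (i + 1) / N)`: it vanishes unless `t` and `x` lie
in the same cell, and is there `N * K u v` for the relative positions `u`, `v` of `t`, `x` in that
cell. As the cells are half-open, `t = 1` lies in a cell outside `[0, 1)`; the results below are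
therefore stated for `t ∈ [0, 1)`. -/
noncomputable def cellKernel (K : ℝ → ℝ → ℝ) (N : ℕ) (t x : ℝ) : ℝ :=
  if ⌊N * t⌋ = ⌊N * x⌋ then N * K (Int.fract (N * t)) (Int.fract (N * x)) else 0

theorem measurable_cellKernel {K : ℝ → ℝ → ℝ} (hK : Measurable (Function.uncurry K)) (N : ℕ) :
    Measurable (Function.uncurry (cellKernel K N)) := by
  have h1 : Measurable fun z : ℝ × ℝ => (N : ℝ) * z.1 := by fun_prop
  have h2 : Measurable fun z : ℝ × ℝ => (N : ℝ) * z.2 := by fun_prop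
  refine Measurable.ite (measurableSet_eq_fun h1.floor h2.floor) ?_ measurable_const
  exact (hK.comp (h1.fract.prodMk h2.fract)).const_mul _

section CellKernel

open Polynomial

variable {K : ℝ → ℝ → ℝ} {A : ℝ} {N : ℕ}

theorem abs_cellKernel_le (hA : 0 ≤ A)
    (hb : ∀ u ∈ Icc (0 : ℝ) 1, ∀ v ∈ Icc (0 : ℝ) 1, |K u v| ≤ A) (t x : ℝ) :
    |cellKernel K N t x| ≤ A * N := by
  unfold cellKernel
  split_ifs with h
  · rw [abs_mul, Nat.abs_cast, mul_comm]
    exact mul_le_mul_of_nonneg_right (hb _ ⟨Int.fract_nonneg _, (Int.fract_lt_one _).le⟩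
      _ ⟨Int.fract_nonneg _, (Int.fract_lt_one _).le⟩) (Nat.cast_nonneg _)
  · rw [abs_zero]
    positivity

theorem mem_cell_iff (hN : 0 < N) {t x : ℝ} :
    ⌊N * t⌋ = ⌊N * x⌋ ↔ x ∈ Ico ((⌊N * t⌋ : ℝ) / N) ((⌊N * t⌋ + 1 : ℝ) / N) := by
  have hN' : (0 : ℝ) < N := by exact_mod_cast hN
  rw [eq_comm, Int.floor_eq_iff, mem_Ico, div_le_iff₀ hN', lt_div_iff₀ hN', mul_comm x]

theorem cell_subset (hN : 0 < N) {t : ℝ} (ht : t ∈ Ico (0 : ℝ) 1) :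
    Ico ((⌊N * t⌋ : ℝ) / N) ((⌊N * t⌋ + 1 : ℝ) / N) ⊆ Ico 0 1 := by
  have hN' : (0 : ℝ) < N := by exact_mod_cast hN
  have h0 : 0 ≤ ⌊N * t⌋ := Int.floor_nonneg.2 (mul_nonneg hN'.le ht.1)
  have h1 : ⌊N * t⌋ < N := Int.floor_lt.2 (by
    push_cast
    nlinarith [ht.2])
  have h0' : (0 : ℝ) ≤ ⌊N * t⌋ := by exact_mod_cast h0
  have h1' : (⌊N * t⌋ : ℝ) + 1 ≤ N := by exact_mod_cast h1
  refine Ico_subset_Ico (by positivity) ((div_le_one hN').2 h1')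

theorem abs_sub_le_of_mem_cell (hN : 0 < N) {t x : ℝ} (h : ⌊N * t⌋ = ⌊N * x⌋) :
    |x - t| ≤ 1 / N := by
  have hN' : (0 : ℝ) < N := by exact_mod_cast hN
  have := Int.abs_sub_lt_one_of_floor_eq_floor h
  rw [le_div_iff₀ hN', abs_sub_comm, ← Nat.abs_cast N, ← abs_mul, sub_mul, mul_comm t, mul_comm x]
  exact this.le

theorem setIntegral_cellKernel_mul (hN : 0 < N) {t : ℝ} (ht : t ∈ Ico (0 : ℝ) 1) (h : ℝ → ℝ) :
    ∫ x in Icc (0 : ℝ) 1, cellKernel K N t x * h x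
      = ∫ x in Ico ((⌊N * t⌋ : ℝ) / N) ((⌊N * t⌋ + 1 : ℝ) / N),
          N * K (Int.fract (N * t)) (Int.fract (N * x)) * h x := by
  rw [setIntegral_eq_of_subset_of_forall_sdiff_eq_zero measurableSet_Icc
    ((cell_subset hN ht).trans Ico_subset_Icc_self) (fun x hx => by
      rw [cellKernel, if_neg (fun h => hx.2 ((mem_cell_iff hN).1 h)), zero_mul])]
  refine setIntegral_congr_fun measurableSet_Ico fun x hx => ?_
  simp only [cellKernel, if_pos ((mem_cell_iff hN).2 hx)]

theorem abs_integral_cellKernel_mul_le (hA : 0 ≤ A)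
    (hb : ∀ u ∈ Icc (0 : ℝ) 1, ∀ v ∈ Icc (0 : ℝ) 1, |K u v| ≤ A)
    (hN : 0 < N) {t : ℝ} (ht : t ∈ Ico (0 : ℝ) 1) {h : ℝ → ℝ} {δ : ℝ}
    (hδ : ∀ x ∈ Ico (0 : ℝ) 1, |x - t| ≤ 1 / N → |h x| ≤ δ) :
    |∫ x in Icc (0 : ℝ) 1, cellKernel K N t x * h x| ≤ A * δ := by
  have hN' : (0 : ℝ) < N := by exact_mod_cast hN
  rw [setIntegral_cellKernel_mul hN ht]
  have := norm_setIntegral_le_of_norm_le_const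
    (μ := volume) (s := Ico ((⌊N * t⌋ : ℝ) / N) ((⌊N * t⌋ + 1 : ℝ) / N))
    (f := fun x => N * K (Int.fract (N * t)) (Int.fract (N * x)) * h x) (C := N * A * δ)
    (by simp) (fun x hx => by
      rw [Real.norm_eq_abs, abs_mul, abs_mul, Nat.abs_cast]
      refine mul_le_mul (mul_le_mul_of_nonneg_left (hb _ ⟨Int.fract_nonneg _,
        (Int.fract_lt_one _).le⟩ _ ⟨Int.fract_nonneg _, (Int.fract_lt_one _).le⟩) hN'.le)
        (hδ x (cell_subset hN ht hx) (abs_sub_le_of_mem_cell hN ((mem_cell_iff hN).2 hx)))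
        (abs_nonneg _) (by positivity))
  refine this.trans (le_of_eq ?_)
  rw [measureReal_def, Real.volume_Ico, add_div, add_sub_cancel_left, ENNReal.toReal_ofReal (by positivity)]
  field_simp

/-- The cell kernel still reproduces polynomials of degree at most `m`, by an affine change of
variable on the cell of `t`. -/
theorem integral_cellKernel_mul_eval {m : ℕ} (hN : 0 < N)
    (hrep : ∀ (P : ℝ[X]), P.natDegree ≤ m → ∀ u,
        ∫ v in (0 : ℝ)..1, K u v * P.eval v = P.eval u)
    {t : ℝ} (ht : t ∈ Ico (0 : ℝ) 1) {P : ℝ[X]} (hP : P.natDegree ≤ m) :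
    ∫ x in Icc (0 : ℝ) 1, cellKernel K N t x * P.eval x = P.eval t := by
  have hN' : (0 : ℝ) < N := by exact_mod_cast hN
  set i : ℤ := ⌊N * t⌋ with hi
  set Q : ℝ[X] := P.comp (C (N : ℝ)⁻¹ * (X + C (i : ℝ))) with hQ
  have hQe : ∀ x : ℝ, Q.eval (N * x - i) = P.eval x := fun x => by
    simp [hQ, hN'.ne']
  have hQd : Q.natDegree ≤ m := by
    refine natDegree_comp_le.trans ?_
    have : (C (N : ℝ)⁻¹ * (X + C (i : ℝ)) : ℝ[X]).natDegree ≤ 1 :=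
      (natDegree_C_mul_le _ _).trans (by rw [natDegree_X_add_C])
    nlinarith
  rw [setIntegral_cellKernel_mul hN ht, integral_Ico_eq_integral_Ioo, ← integral_Ioc_eq_integral_Ioo]
  rw [← intervalIntegral.integral_of_le (by gcongr; linarith)]
  have hcongr : ∫ x in ((i : ℝ) / N)..((i + 1 : ℝ) / N),
        N * K (Int.fract (N * t)) (Int.fract (N * x)) * P.eval x
      = ∫ x in ((i : ℝ) / N)..((i + 1 : ℝ) / N),
        N * (K (Int.fract (N * t)) (N * x - i) * Q.eval (N * x - i)) := by
    refine intervalIntegral.integral_congr_ae ?_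
    have hne : ∀ᵐ x : ℝ, x ≠ (i + 1 : ℝ) / N := by
      simp [ae_iff]
    filter_upwards [hne] with x hx hx'
    rw [uIoc_of_le (by gcongr; linarith)] at hx'
    have : ⌊N * t⌋ = ⌊N * x⌋ := (mem_cell_iff hN).2 ⟨hx'.1.le, lt_of_le_of_ne hx'.2 hx⟩
    have hfr : Int.fract ((N : ℝ) * x) = N * x - i := by
      rw [Int.fract, ← this]
    rw [hQe, hfr, mul_assoc]
  rw [hcongr, intervalIntegral.integral_const_mul,
    intervalIntegral.mul_integral_comp_mul_sub
      (f := fun v => K (Int.fract (N * t)) v * Q.eval v)]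
  rw [mul_div_cancel₀ _ hN'.ne', mul_div_cancel₀ _ hN'.ne', sub_self, add_sub_cancel_left,
    hrep Q hQd]
  exact hQe t

end CellKernel

/-! ### Upper bound on the minimax risk -/

section UpperBound

open Polynomial

variable {K : ℝ → ℝ → ℝ} {A β L : ℝ} {N : ℕ} {f : ℝ → ℝ}

theorem integrableOn_cellKernel_mul (hK : Measurable (Function.uncurry K)) (hA : 0 ≤ A)
    (hb : ∀ u ∈ Icc (0 : ℝ) 1, ∀ v ∈ Icc (0 : ℝ) 1, |K u v| ≤ A) (t : ℝ)
    (hf : IntegrableOn f (Icc 0 1)) :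
    IntegrableOn (fun x => cellKernel K N t x * f x) (Icc 0 1) :=
  hf.bdd_mul (c := A * N)
    ((measurable_cellKernel hK N).comp measurable_prodMk_left).aestronglyMeasurable
    (ae_of_all _ (abs_cellKernel_le hA hb t))

/-- The bias of the cell kernel: subtracting the Taylor polynomial at `t`, which is reproduced
exactly, leaves an error of order `N ^ (-β)` on the cell of `t`. -/
theorem abs_integral_cellKernel_mul_sub_le (hK : Measurable (Function.uncurry K)) (hA : 0 ≤ A)
    (hb : ∀ u ∈ Icc (0 : ℝ) 1, ∀ v ∈ Icc (0 : ℝ) 1, |K u v| ≤ A)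
    (hrep : ∀ (P : ℝ[X]), P.natDegree ≤ order β → ∀ u,
        ∫ v in (0 : ℝ)..1, K u v * P.eval v = P.eval u)
    (hβ : 0 < β) (hL : 0 ≤ L) (hf : f ∈ holderClass β L)
    (hN : 0 < N) {t : ℝ} (ht : t ∈ Ico (0 : ℝ) 1) :
    |(∫ x in Icc (0 : ℝ) 1, cellKernel K N t x * f x) - f t| ≤ A * (L * (N : ℝ) ^ (-β)) := by
  obtain ⟨P, hP, hPt, hPx⟩ :=
    exists_polynomial_of_mem_holderClass hβ hL hf (Ico_subset_Icc_self ht)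
  have hPi : IntegrableOn (fun x => P.eval x) (Icc 0 1) :=
    P.continuous.continuousOn.integrableOn_compact isCompact_Icc
  have hsub : (∫ x in Icc (0 : ℝ) 1, cellKernel K N t x * f x) - f t
      = ∫ x in Icc (0 : ℝ) 1, cellKernel K N t x * (f x - P.eval x) := by
    rw [← hPt, ← integral_cellKernel_mul_eval hN hrep ht hP, ← integral_sub
      (integrableOn_cellKernel_mul hK hA hb t hf.1.2.1)
      (integrableOn_cellKernel_mul hK hA hb t hPi)]
    simp_rw [mul_sub]
  rw [hsub]
  refine abs_integral_cellKernel_mul_le hA hb hN ht fun x hx hxt => ?_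
  refine (hPx x (Ico_subset_Icc_self hx)).trans (mul_le_mul_of_nonneg_left ?_ hL)
  rw [Real.rpow_neg (Nat.cast_nonneg _), ← Real.inv_rpow (Nat.cast_nonneg _), ← one_div]
  exact Real.rpow_le_rpow (abs_nonneg _) hxt hβ.le

/-- The densities of the Hölder class are uniformly bounded on `[0, 1)`: this is the bias bound for a
single cell, where the average against the kernel is at most `A` because `f` has integral one. -/
theorem le_of_mem_holderClass (hK : Measurable (Function.uncurry K)) (hA : 0 ≤ A)
    (hb : ∀ u ∈ Icc (0 : ℝ) 1, ∀ v ∈ Icc (0 : ℝ) 1, |K u v| ≤ A)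
    (hrep : ∀ (P : ℝ[X]), P.natDegree ≤ order β → ∀ u,
        ∫ v in (0 : ℝ)..1, K u v * P.eval v = P.eval u)
    (hβ : 0 < β) (hL : 0 ≤ L) (hf : f ∈ holderClass β L)
    {t : ℝ} (ht : t ∈ Ico (0 : ℝ) 1) : f t ≤ A * (1 + L) := by
  have h1 := abs_integral_cellKernel_mul_sub_le hK hA hb hrep hβ hL hf one_pos ht
  have h2 : ∫ x in Icc (0 : ℝ) 1, cellKernel K 1 t x * f x
      ≤ ∫ x in Icc (0 : ℝ) 1, A * f x := by
    refine setIntegral_mono_on (integrableOn_cellKernel_mul hK hA hb t hf.1.2.1)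
      (hf.1.2.1.const_mul _) measurableSet_Icc fun x hx => ?_
    refine mul_le_mul_of_nonneg_right ?_ (hf.1.1 x hx)
    simpa using (le_abs_self _).trans (abs_cellKernel_le (N := 1) hA hb t x)
  rw [integral_const_mul, hf.1.2.2] at h2
  have := (abs_le.1 h1).1
  simp at this
  linarith

theorem integral_sq_cellKernel_le (hA : 0 ≤ A)
    (hb : ∀ u ∈ Icc (0 : ℝ) 1, ∀ v ∈ Icc (0 : ℝ) 1, |K u v| ≤ A)
    (hf : IsDensity f) {F : ℝ} (hF : ∀ x ∈ Ico (0 : ℝ) 1, f x ≤ F)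
    (hN : 0 < N) {t : ℝ} (ht : t ∈ Ico (0 : ℝ) 1) :
    ∫ x, cellKernel K N t x ^ 2 ∂(law f) ≤ A ^ 2 * F * N := by
  rw [integral_law hf]
  have h : ∫ x in Icc (0 : ℝ) 1, cellKernel K N t x ^ 2 * f x
      = ∫ x in Icc (0 : ℝ) 1, cellKernel K N t x * (cellKernel K N t x * f x) := by
    simp_rw [sq, mul_assoc]
  rw [h]
  refine (le_abs_self _).trans ((abs_integral_cellKernel_mul_le hA hb hN ht
    (δ := A * N * F) fun x hx _ => ?_).trans (le_of_eq (by ring)))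
  rw [abs_mul, abs_of_nonneg (hf.1 x (Ico_subset_Icc_self hx))]
  exact mul_le_mul (abs_cellKernel_le hA hb t x) (hF x hx)
    (hf.1 x (Ico_subset_Icc_self hx)) (by positivity)

/-- The estimator that averages the cell kernel over the sample. -/
noncomputable def cellEstimator (K : ℝ → ℝ → ℝ) (N n : ℕ) (X : Fin n → ℝ) (t : ℝ) : ℝ :=
  (1 / (n : ℝ)) * ∑ k, cellKernel K N t (X k)

theorem isEstimator_cellEstimator (hK : Measurable (Function.uncurry K)) (N n : ℕ) :
    IsEstimator (cellEstimator K N n) := by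
  refine Measurable.const_mul (Finset.measurable_sum _ fun k _ => ?_) _
  exact (measurable_cellKernel hK N).comp
    (measurable_snd.prodMk ((measurable_pi_apply k).comp measurable_fst))

/-- Pointwise risk of the cell estimator, as the sum of a stochastic term and of the bias. -/
theorem lintegral_cellEstimator_sub_le (hK : Measurable (Function.uncurry K)) (hA : 1 ≤ A)
    (hb : ∀ u ∈ Icc (0 : ℝ) 1, ∀ v ∈ Icc (0 : ℝ) 1, |K u v| ≤ A)
    (hrep : ∀ (P : ℝ[X]), P.natDegree ≤ order β → ∀ u,
        ∫ v in (0 : ℝ)..1, K u v * P.eval v = P.eval u)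
    (hβ : 0 < β) (hL : 0 ≤ L) (hf : f ∈ holderClass β L) {p : ℝ} (hp : 1 ≤ p)
    (hN : 0 < N) {n : ℕ} (hn : N ≤ n) {t : ℝ} (ht : t ∈ Ico (0 : ℝ) 1) :
    ∫⁻ X, ‖cellEstimator K N n X t - f t‖ₑ ^ p ∂(sampleLaw n f)
      ≤ (2 * ENNReal.ofReal (4 * Real.exp 1 * p * A * √(A * (1 + L)) * √((N : ℝ) / n)
          + A * (L * (N : ℝ) ^ (-β)))) ^ p := by
  have hp0 : 0 < p := by linarith
  have hA0 : 0 < A := by linarith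
  have hN' : (0 : ℝ) < N := by exact_mod_cast hN
  have hn' : (0 : ℝ) < n := by exact_mod_cast hN.trans_le hn
  have hNn : (N : ℝ) ≤ n := by exact_mod_cast hn
  have := isProbabilityMeasure_law hf.1
  set F := A * (1 + L) with hF
  have hF1 : 1 ≤ F := by nlinarith
  set g : ℝ → ℝ := cellKernel K N t with hg
  have hgm : Measurable g := (measurable_cellKernel hK N).comp measurable_prodMk_left
  set m := ∫ x, g x ∂(law f) with hm
  have hbias : |m - f t| ≤ A * (L * (N : ℝ) ^ (-β)) := by
    rw [hm, integral_law hf.1]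
    exact abs_integral_cellKernel_mul_sub_le hK hA0.le hb hrep hβ hL hf hN ht
  set w := √(F * n * N) with hw
  have hw0 : 0 < w := Real.sqrt_pos.2 (by positivity)
  have hw2 : w ^ 2 = F * n * N := Real.sq_sqrt (by positivity)
  -- With this `s` the exponential moment condition reads `n * s ^ 2 * (A ^ 2 * F * N) = 1 / 4`,
  -- and `N ≤ n` makes `s * (2 * A * N) ≤ 1`.
  set s := 1 / (2 * A * w) with hs
  have hs0 : 0 < s := by positivity
  have hNw : (N : ℝ) ≤ w := Real.le_sqrt_of_sq_le (by
    calc (N : ℝ) ^ 2 = 1 * N * N := by ring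
      _ ≤ F * n * N := by gcongr)
  have hmom := lintegral_rpow_sum_sub_integral_le (μ := law f) hgm
    (abs_cellKernel_le hA0.le hb t) (integral_sq_cellKernel_le hA0.le hb hf.1
      (fun x hx => le_of_mem_holderClass hK hA0.le hb hrep hβ hL hf hx) hN ht) hs0
    (by
      rw [hs, one_div, inv_mul_le_iff₀ (by positivity)]
      nlinarith) (n := n)
    (by
      have : (n : ℝ) * (s ^ 2 * (A ^ 2 * F * N)) = 1 / 4 := by
        rw [hs, div_pow, mul_pow, hw2]
        field_simp
        norm_num
      rw [this]
      norm_num) hp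
  rw [← hm] at hmom
  have hdec : ∀ X : Fin n → ℝ, cellEstimator K N n X t - f t
      = (1 / (n : ℝ)) * ∑ k, (g (X k) - m) + (m - f t) := fun X => by
    rw [cellEstimator, Finset.sum_sub_distrib, Finset.sum_const, Finset.card_univ,
      Fintype.card_fin, nsmul_eq_mul]
    field_simp
    ring
  set D : ℝ := 4 * Real.exp 1 * p * A * √F * √((N : ℝ) / n) with hD
  set B : ℝ := A * (L * (N : ℝ) ^ (-β)) with hB
  have hD0 : 0 ≤ D := by positivity
  have hB0 : 0 ≤ B := by positivity
  have hDeq : ENNReal.ofReal (1 / (n : ℝ)) * ENNReal.ofReal (2 * Real.exp 1 * p / s)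
      = ENNReal.ofReal D := by
    rw [← ENNReal.ofReal_mul (by positivity)]
    congr 1
    have hwn : w = √F * √((N : ℝ) / n) * n := by
      rw [hw, ← Real.sqrt_mul (by positivity), ← Real.sqrt_sq hn'.le, ← Real.sqrt_mul (by positivity),
        Real.sqrt_sq hn'.le]
      congr 1
      field_simp
    rw [hs, hD, hwn]
    field_simp
    ring
  have hmeas : Measurable fun X : Fin n → ℝ => ‖∑ k, (g (X k) - m)‖ₑ ^ p := by fun_prop
  calc ∫⁻ X, ‖cellEstimator K N n X t - f t‖ₑ ^ p ∂(sampleLaw n f)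
      ≤ ∫⁻ X, 2 ^ (p - 1) * (ENNReal.ofReal (1 / (n : ℝ)) ^ p * ‖∑ k, (g (X k) - m)‖ₑ ^ p
          + ENNReal.ofReal B ^ p) ∂(sampleLaw n f) := by
        refine lintegral_mono fun X => ?_
        rw [hdec]
        refine (ENNReal.rpow_le_rpow (enorm_add_le _ _) hp0.le).trans ?_
        refine (ENNReal.rpow_add_le_mul_rpow_add_rpow _ _ hp).trans ?_
        rw [enorm_mul, ENNReal.mul_rpow_of_nonneg _ _ hp0.le,
          Real.enorm_of_nonneg (by positivity : 0 ≤ 1 / (n : ℝ))]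
        gcongr
        rw [Real.enorm_eq_ofReal_abs]
        exact ENNReal.ofReal_le_ofReal hbias
    _ = 2 ^ (p - 1) * (ENNReal.ofReal (1 / (n : ℝ)) ^ p
          * ∫⁻ X : Fin n → ℝ, ‖∑ k, (g (X k) - m)‖ₑ ^ p ∂(sampleLaw n f)
          + ENNReal.ofReal B ^ p) := by
        have : IsProbabilityMeasure (sampleLaw n f) := by
          unfold sampleLaw
          infer_instance
        rw [lintegral_const_mul _ (by fun_prop), lintegral_add_right _ measurable_const,
          lintegral_const_mul _ hmeas, lintegral_const, measure_univ, mul_one]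
    _ ≤ 2 ^ (p - 1) * (ENNReal.ofReal D ^ p + ENNReal.ofReal B ^ p) := by
        rw [← hDeq, ENNReal.mul_rpow_of_nonneg _ _ hp0.le]
        gcongr
        exact hmom
    _ ≤ 2 ^ p * (ENNReal.ofReal D + ENNReal.ofReal B) ^ p := by
        refine mul_le_mul' (ENNReal.rpow_le_rpow_of_exponent_le one_le_two (by linarith))
          (ENNReal.add_rpow_le_rpow_add _ _ hp)
    _ = _ := by
        rw [ENNReal.mul_rpow_of_nonneg _ _ hp0.le, ENNReal.ofReal_add hD0 hB0]

/-- Minimax upper bound in terms of the number `N` of cells, with a constant depending only on `p`,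
`β` and `L`. -/
theorem exists_minimaxRisk_le {p : ℝ} (hp : 1 ≤ p) (hβ : 0 < β) (hL : 0 ≤ L) :
    ∃ C : ℝ, 0 < C ∧ ∀ n N : ℕ, 0 < N → N ≤ n →
      minimaxRisk p β L n ≤ ENNReal.ofReal (C * ((N : ℝ) ^ (-β) + √((N : ℝ) / n))) := by
  have hp0 : 0 < p := by linarith
  obtain ⟨K, A, hKc, hA, hb, hrep⟩ := exists_reproducing_kernel (order β)
  have hK := hKc.measurable
  have hA0 : 0 < A := by linarith
  set C₁ := 4 * Real.exp 1 * p * A * √(A * (1 + L)) with hC₁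
  have hC₁0 : 0 ≤ C₁ := by positivity
  refine ⟨2 * (C₁ + A * L) + 1, by positivity, fun n N hN hn => ?_⟩
  have hest := isEstimator_cellEstimator hK N n
  refine (iInf₂_le (cellEstimator K N n) hest).trans (iSup₂_le fun f hf => ?_)
  have := isProbabilityMeasure_law hf.1
  have hprob : IsProbabilityMeasure (sampleLaw n f) := by
    unfold sampleLaw
    infer_instance
  have hmeas : AEMeasurable (Function.uncurry fun (X : Fin n → ℝ) (t : ℝ) =>
      ‖cellEstimator K N n X t - f t‖ₑ ^ p)
      ((sampleLaw n f).prod (volume.restrict (Icc 0 1))) := by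
    refine AEMeasurable.pow_const (AEMeasurable.enorm (AEMeasurable.sub hest.aemeasurable ?_)) _
    exact hf.1.2.1.aemeasurable.comp_snd
  -- The pointwise bounds hold on `[0, 1)` only, which has full measure in `[0, 1]`.
  rw [risk, lintegral_lintegral_swap hmeas, one_div]
  set R := 2 * ENNReal.ofReal (C₁ * √((N : ℝ) / n) + A * (L * (N : ℝ) ^ (-β))) with hR
  have hle : ∫⁻ t in Icc (0 : ℝ) 1, ∫⁻ X, ‖cellEstimator K N n X t - f t‖ₑ ^ p ∂(sampleLaw n f)
      ≤ R ^ p := by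
    rw [← restrict_Ico_eq_restrict_Icc]
    refine (setLIntegral_mono measurable_const fun t ht =>
      lintegral_cellEstimator_sub_le hK hA hb hrep hβ hL hf hp hN hn ht).trans ?_
    simp [hR, hC₁]
  refine (ENNReal.rpow_le_rpow hle (by positivity)).trans ?_
  rw [ENNReal.rpow_rpow_inv hp0.ne', hR, show (2 : ℝ≥0∞) = ENNReal.ofReal 2 by simp,
    ← ENNReal.ofReal_mul zero_le_two]
  refine ENNReal.ofReal_le_ofReal ?_
  have h1 : 0 ≤ √((N : ℝ) / n) := Real.sqrt_nonneg _
  have h2 : 0 ≤ (N : ℝ) ^ (-β) := by positivity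
  have h3 : 0 ≤ A * L := by positivity
  nlinarith [mul_nonneg hC₁0 h2, mul_nonneg h3 h1]

end UpperBound

/-! ### Moments of the beta kernel -/

section BetaMoments

open ProbabilityTheory

theorem beta_add_one {u v : ℝ} (hu : 0 < u) (hv : 0 < v) :
    beta (u + 1) v = u / (u + v) * beta u v := by
  have h : u + v ≠ 0 := by positivity
  have hG : Real.Gamma (u + v) ≠ 0 := (Real.Gamma_pos_of_pos (by positivity)).ne'
  rw [beta, beta, Real.Gamma_add_one hu.ne', add_right_comm, Real.Gamma_add_one h]
  field_simp

theorem integral_rpow_mul_one_sub_rpow {a c : ℝ} (ha : 0 ≤ a) (hc : 0 ≤ c) :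
    ∫ x in Icc (0 : ℝ) 1, x ^ a * (1 - x) ^ c = beta (a + 1) (c + 1) := by
  have hre : ((beta (a + 1) (c + 1) : ℝ) : ℂ)
      = Complex.betaIntegral ((a + 1 : ℝ) : ℂ) ((c + 1 : ℝ) : ℂ) := by
    rw [Complex.betaIntegral_eq_Gamma_mul_div _ _ (by simp; linarith) (by simp; linarith), beta,
      ← Complex.ofReal_add, Complex.Gamma_ofReal, Complex.Gamma_ofReal, Complex.Gamma_ofReal]
    norm_cast
  apply Complex.ofReal_injective
  rw [hre, Complex.betaIntegral, integral_Icc_eq_integral_Ioc,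
    ← intervalIntegral.integral_of_le zero_le_one, ← intervalIntegral.integral_ofReal]
  refine intervalIntegral.integral_congr fun x hx => ?_
  rw [uIcc_of_le zero_le_one] at hx
  rw [Complex.ofReal_mul, Complex.ofReal_cpow hx.1, Complex.ofReal_cpow (sub_nonneg.2 hx.2)]
  push_cast
  simp

variable {b t : ℝ}

theorem beta_kernel_pos (hb : 0 < b) (ht : t ∈ Icc (0 : ℝ) 1) :
    0 < beta (t / b + 1) ((1 - t) / b + 1) :=
  beta_pos (by have := div_nonneg ht.1 hb.le; linarith)
    (by have := div_nonneg (sub_nonneg.2 ht.2) hb.le; linarith)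

theorem measurable_betaKernel (b t : ℝ) : Measurable (betaKernel b t) := by
  unfold betaKernel
  exact Measurable.indicator (by fun_prop) measurableSet_Icc

theorem betaKernel_nonneg (hb : 0 < b) (ht : t ∈ Icc (0 : ℝ) 1) (x : ℝ) :
    0 ≤ betaKernel b t x := by
  refine indicator_nonneg (fun x hx => ?_) x
  have h1 := Real.rpow_nonneg hx.1 (t / b)
  have h2 := Real.rpow_nonneg (sub_nonneg.2 hx.2) ((1 - t) / b)
  exact div_nonneg (mul_nonneg h1 h2) (beta_kernel_pos hb ht).le

theorem abs_betaKernel_le (hb : 0 < b) (ht : t ∈ Icc (0 : ℝ) 1) (x : ℝ) :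
    |betaKernel b t x| ≤ 1 / beta (t / b + 1) ((1 - t) / b + 1) := by
  have hB := beta_kernel_pos hb ht
  rw [abs_of_nonneg (betaKernel_nonneg hb ht x)]
  refine indicator_apply_le' (fun hx => ?_) fun _ => by positivity
  refine div_le_div_of_nonneg_right (mul_le_one₀ ?_ ?_ ?_) hB.le
  · exact Real.rpow_le_one hx.1 hx.2 (div_nonneg ht.1 hb.le)
  · exact Real.rpow_nonneg (sub_nonneg.2 hx.2) _
  · exact Real.rpow_le_one (sub_nonneg.2 hx.2) (by linarith [hx.1])
      (div_nonneg (sub_nonneg.2 ht.2) hb.le)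

theorem integrable_betaKernel {μ : Measure ℝ} [IsFiniteMeasure μ] (hb : 0 < b)
    (ht : t ∈ Icc (0 : ℝ) 1) : Integrable (betaKernel b t) μ :=
  Integrable.of_bound (measurable_betaKernel b t).aestronglyMeasurable _
    (ae_of_all _ (abs_betaKernel_le hb ht))

theorem integrableOn_betaKernel_mul (hb : 0 < b) (ht : t ∈ Icc (0 : ℝ) 1) {g : ℝ → ℝ}
    (hg : IntegrableOn g (Icc 0 1)) :
    IntegrableOn (fun x => betaKernel b t x * g x) (Icc 0 1) :=
  hg.bdd_mul (measurable_betaKernel b t).aestronglyMeasurable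
    (ae_of_all _ (abs_betaKernel_le hb ht))

theorem integral_betaKernel_mul_pow (hb : 0 < b) (ht : t ∈ Icc (0 : ℝ) 1) (k : ℕ) :
    ∫ x in Icc (0 : ℝ) 1, betaKernel b t x * x ^ k
      = beta (t / b + k + 1) ((1 - t) / b + 1) / beta (t / b + 1) ((1 - t) / b + 1) := by
  have ha : 0 ≤ t / b := div_nonneg ht.1 hb.le
  rw [← integral_rpow_mul_one_sub_rpow (add_nonneg ha (Nat.cast_nonneg k))
    (div_nonneg (sub_nonneg.2 ht.2) hb.le), ← integral_div]
  refine setIntegral_congr_fun measurableSet_Icc fun x hx => ?_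
  simp only [betaKernel, indicator_of_mem hx]
  rw [Real.rpow_add_of_nonneg hx.1 ha (Nat.cast_nonneg k), Real.rpow_natCast]
  ring

theorem integral_betaKernel (hb : 0 < b) (ht : t ∈ Icc (0 : ℝ) 1) :
    ∫ x in Icc (0 : ℝ) 1, betaKernel b t x = 1 := by
  have := integral_betaKernel_mul_pow hb ht 0
  simpa [(beta_kernel_pos hb ht).ne'] using this

theorem integral_betaKernel_mul_id (hb : 0 < b) (ht : t ∈ Icc (0 : ℝ) 1) :
    ∫ x in Icc (0 : ℝ) 1, betaKernel b t x * x = (t + b) / (1 + 2 * b) := by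
  have h := integral_betaKernel_mul_pow hb ht 1
  have ha : 0 ≤ t / b := div_nonneg ht.1 hb.le
  have hc : 0 ≤ (1 - t) / b := div_nonneg (sub_nonneg.2 ht.2) hb.le
  have hB := (beta_kernel_pos hb ht).ne'
  simp only [pow_one, Nat.cast_one] at h
  rw [h, beta_add_one (by positivity) (by positivity), mul_div_cancel_right₀ _ hB]
  have e1 : t / b + 1 = (t + b) / b := by field_simp
  have e2 : (t + b) / b + ((1 - t) / b + 1) = (1 + 2 * b) / b := by field_simp; ring
  rw [e1, e2]
  field_simp

theorem integral_betaKernel_mul_sq (hb : 0 < b) (ht : t ∈ Icc (0 : ℝ) 1) :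
    ∫ x in Icc (0 : ℝ) 1, betaKernel b t x * x ^ 2
      = (t + b) * (t + 2 * b) / ((1 + 2 * b) * (1 + 3 * b)) := by
  have h := integral_betaKernel_mul_pow hb ht 2
  have ha : 0 ≤ t / b := div_nonneg ht.1 hb.le
  have hc : 0 ≤ (1 - t) / b := div_nonneg (sub_nonneg.2 ht.2) hb.le
  have hB := (beta_kernel_pos hb ht).ne'
  have e : t / b + ((2 : ℕ) : ℝ) + 1 = t / b + 1 + 1 + 1 := by push_cast; ring
  rw [h, e, beta_add_one (by positivity) (by positivity),
    beta_add_one (by positivity) (by positivity), ← mul_assoc, mul_div_cancel_right₀ _ hB]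
  have e1 : t / b + 1 + 1 = (t + 2 * b) / b := by field_simp; ring
  have e2 : t / b + 1 = (t + b) / b := by field_simp
  have e3 : (t + 2 * b) / b + ((1 - t) / b + 1) = (1 + 3 * b) / b := by field_simp; ring
  have e4 : (t + b) / b + ((1 - t) / b + 1) = (1 + 2 * b) / b := by field_simp; ring
  rw [e1, e2, e3, e4]
  field_simp

theorem integral_betaKernel_mul_sub_mean_sq_le (hb : 0 < b) (ht : t ∈ Icc (0 : ℝ) 1) :
    ∫ x in Icc (0 : ℝ) 1, betaKernel b t x * (x - (t + b) / (1 + 2 * b)) ^ 2 ≤ b / 4 := by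
  set μ := (t + b) / (1 + 2 * b) with hμ
  have h : ∀ x, betaKernel b t x * (x - μ) ^ 2 = betaKernel b t x * x ^ 2
      - 2 * μ * (betaKernel b t x * x) + μ ^ 2 * betaKernel b t x := fun x => by ring
  have i2 : IntegrableOn (fun x => betaKernel b t x * x ^ 2) (Icc 0 1) :=
    integrableOn_betaKernel_mul hb ht
      ((continuous_pow 2).continuousOn.integrableOn_compact isCompact_Icc)
  have i1 : IntegrableOn (fun x => betaKernel b t x * x) (Icc 0 1) :=
    integrableOn_betaKernel_mul hb ht
      (continuous_id.continuousOn.integrableOn_compact isCompact_Icc)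
  have i0 : IntegrableOn (betaKernel b t) (Icc 0 1) := integrable_betaKernel hb ht
  have i21 : IntegrableOn (fun x => betaKernel b t x * x ^ 2
      - 2 * μ * (betaKernel b t x * x)) (Icc 0 1) := i2.sub (i1.const_mul _)
  simp_rw [h]
  rw [integral_add i21 (i0.const_mul _), integral_sub i2 (i1.const_mul _), integral_const_mul,
    integral_const_mul, integral_betaKernel hb ht, integral_betaKernel_mul_id hb ht,
    integral_betaKernel_mul_sq hb ht, ← hμ]
  have h2 : (t + b) * (t + 2 * b) / ((1 + 2 * b) * (1 + 3 * b)) - 2 * μ * μ + μ ^ 2 * 1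
      = b * ((t + b) * (1 - t + b) / (1 + 2 * b) ^ 2) / (1 + 3 * b) := by
    rw [hμ]
    field_simp
    ring
  rw [h2]
  have h3 : (t + b) * (1 - t + b) / (1 + 2 * b) ^ 2 ≤ 1 / 4 := by
    rw [div_le_iff₀ (by positivity)]
    nlinarith [sq_nonneg (2 * t - 1)]
  have h4 : 0 ≤ (t + b) * (1 - t + b) / (1 + 2 * b) ^ 2 := by
    have : 0 ≤ t + b := by linarith [ht.1]
    have : 0 ≤ 1 - t + b := by linarith [ht.2]
    positivity
  calc _ ≤ b * ((t + b) * (1 - t + b) / (1 + 2 * b) ^ 2) :=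
        div_le_self (by positivity) (by linarith)
    _ ≤ b / 4 := by nlinarith

/-- The beta kernel is a probability density of variance at most `b / 4`, so it is concentrated on an
interval of length of order `√b` and its squared `L²` norm is at least of order `b ^ (-1/2)`.
The bound integrates `k ^ 2 ≥ 2 * s * k - s ^ 2` over `|x - μ| ≤ √b`, the mass outside that
interval being controlled by the second moment. -/
theorem le_integral_betaKernel_sq (hb : 0 < b) (ht : t ∈ Icc (0 : ℝ) 1) :
    9 / (32 * √b) ≤ ∫ x in Icc (0 : ℝ) 1, betaKernel b t x ^ 2 := by
  set μ := (t + b) / (1 + 2 * b) with hμ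
  set δ := √b with hδ
  have hδ0 : 0 < δ := Real.sqrt_pos.2 hb
  have hδ2 : δ ^ 2 = b := Real.sq_sqrt hb.le
  -- This `s` maximizes the resulting bound `3 / 2 * s - 2 * δ * s ^ 2`.
  set s := 3 / (8 * δ) with hs
  have hs0 : 0 < s := by positivity
  set w : ℝ → ℝ := (Icc (μ - δ) (μ + δ)).indicator fun _ => s ^ 2 with hw
  have i0 : IntegrableOn (betaKernel b t) (Icc 0 1) := integrable_betaKernel hb ht
  have isq : IntegrableOn (fun x => betaKernel b t x ^ 2) (Icc 0 1) := by
    simp_rw [sq]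
    exact integrableOn_betaKernel_mul hb ht i0
  have iv : IntegrableOn (fun x => betaKernel b t x * (x - μ) ^ 2) (Icc 0 1) :=
    integrableOn_betaKernel_mul hb ht (((continuous_id.sub continuous_const).pow
      2).continuousOn.integrableOn_compact isCompact_Icc)
  have iw' : Integrable w volume :=
    (integrable_indicator_iff measurableSet_Icc).2 (integrableOn_const (by simp))
  have iw : IntegrableOn w (Icc 0 1) := iw'.integrableOn
  have hpt : ∀ x, 2 * s * betaKernel b t x - 2 * s / b * (betaKernel b t x * (x - μ) ^ 2) - w x
      ≤ betaKernel b t x ^ 2 := fun x => by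
    have hK := betaKernel_nonneg hb ht x
    set k := betaKernel b t x
    by_cases hx : x ∈ Icc (μ - δ) (μ + δ)
    · rw [hw, indicator_of_mem hx]
      have : 0 ≤ 2 * s / b * (k * (x - μ) ^ 2) := by positivity
      nlinarith [sq_nonneg (k - s)]
    · rw [hw, indicator_of_notMem hx]
      have h1 : b ≤ (x - μ) ^ 2 := by
        rw [← hδ2]
        rw [mem_Icc, not_and_or, not_le, not_le] at hx
        rcases hx with hx | hx <;> nlinarith
      have h2 : 2 * s * k ≤ 2 * s / b * (k * (x - μ) ^ 2) := by
        calc 2 * s * k = 2 * s / b * (k * b) := by field_simp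
          _ ≤ _ := by gcongr
      nlinarith [sq_nonneg k]
  have hwint : ∫ x in Icc (0 : ℝ) 1, w x ≤ s ^ 2 * (2 * δ) := by
    refine (setIntegral_le_integral iw' (ae_of_all _ fun x =>
      indicator_nonneg (fun _ _ => sq_nonneg s) x)).trans (le_of_eq ?_)
    rw [hw, integral_indicator measurableSet_Icc, setIntegral_const, measureReal_def,
      Real.volume_Icc, ENNReal.toReal_ofReal (by linarith), smul_eq_mul]
    ring
  have i1 : IntegrableOn (fun x => 2 * s * betaKernel b t x
      - 2 * s / b * (betaKernel b t x * (x - μ) ^ 2)) (Icc 0 1) :=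
    (i0.const_mul _).sub (iv.const_mul _)
  have hmono := setIntegral_mono (i1.sub iw) isq hpt
  have hlhs : ∫ x in Icc (0 : ℝ) 1, (2 * s * betaKernel b t x
      - 2 * s / b * (betaKernel b t x * (x - μ) ^ 2) - w x)
      = 2 * s - 2 * s / b * (∫ x in Icc (0 : ℝ) 1, betaKernel b t x * (x - μ) ^ 2)
        - ∫ x in Icc (0 : ℝ) 1, w x := by
    rw [integral_sub i1 iw, integral_sub (i0.const_mul _) (iv.const_mul _), integral_const_mul,
      integral_const_mul, integral_betaKernel hb ht, mul_one]
  have hvar : 2 * s / b * (∫ x in Icc (0 : ℝ) 1, betaKernel b t x * (x - μ) ^ 2) ≤ s / 2 := by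
    calc _ ≤ 2 * s / b * (b / 4) :=
          mul_le_mul_of_nonneg_left (integral_betaKernel_mul_sub_mean_sq_le hb ht) (by positivity)
      _ = s / 2 := by field_simp; norm_num
  have hval : 9 / (32 * δ) = 2 * s - s / 2 - s ^ 2 * (2 * δ) := by
    rw [hs]
    field_simp
    norm_num
  have hmono' : 2 * s - 2 * s / b * (∫ x in Icc (0 : ℝ) 1, betaKernel b t x * (x - μ) ^ 2)
        - ∫ x in Icc (0 : ℝ) 1, w x ≤ ∫ x in Icc (0 : ℝ) 1, betaKernel b t x ^ 2 := by
    rw [← hlhs]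
    exact hmono
  linarith

end BetaMoments

open ProbabilityTheory

/-! ### Lower bound on the risk of the beta kernel estimator -/

section Risk

variable {p β L b : ℝ} {n : ℕ} {f : ℝ → ℝ}

/-- The beta kernel estimator is jointly measurable up to null sets. The restriction to `t ∈ [0, 1]`
keeps the arguments of the Gamma functions positive, where `Gamma` is continuous. -/
theorem aemeasurable_betaEstimator {μ : Measure (Fin n → ℝ)} [SFinite μ] (hb : 0 < b) :
    AEMeasurable (Function.uncurry (betaEstimator n b)) (μ.prod (volume.restrict (Icc 0 1))) := by
  have hΓ : ∀ {s : ℝ → ℝ}, Continuous s → (∀ t ∈ Icc (0 : ℝ) 1, 0 < s t) →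
      ContinuousOn (fun t => Real.Gamma (s t)) (Icc 0 1) := fun {s} hs h0 t ht =>
    ((Real.differentiableAt_Gamma fun m => by
      have := h0 t ht
      have : (0 : ℝ) ≤ m := Nat.cast_nonneg m
      linarith).continuousAt.comp hs.continuousAt).continuousWithinAt
  have hpos1 : ∀ t ∈ Icc (0 : ℝ) 1, 0 < t / b + 1 := fun t ht => by
    have := div_nonneg ht.1 hb.le
    linarith
  have hpos2 : ∀ t ∈ Icc (0 : ℝ) 1, 0 < (1 - t) / b + 1 := fun t ht => by
    have := div_nonneg (sub_nonneg.2 ht.2) hb.le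
    linarith
  have hB : ContinuousOn (fun t => beta (t / b + 1) ((1 - t) / b + 1)) (Icc 0 1) :=
    ((hΓ (by fun_prop) hpos1).mul (hΓ (by fun_prop) hpos2)).div
      (hΓ (by fun_prop) fun t ht => add_pos (hpos1 t ht) (hpos2 t ht))
      fun t ht => (Real.Gamma_pos_of_pos (add_pos (hpos1 t ht) (hpos2 t ht))).ne'
  have hBm : AEMeasurable (fun t => beta (t / b + 1) ((1 - t) / b + 1))
      (volume.restrict (Icc 0 1)) := hB.aemeasurable measurableSet_Icc
  refine AEMeasurable.const_mul (Finset.aemeasurable_fun_sum _ fun k _ => ?_) _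
  have hnum : Measurable fun z : (Fin n → ℝ) × ℝ =>
      (z.1 k) ^ (z.2 / b) * (1 - z.1 k) ^ ((1 - z.2) / b) := by fun_prop
  have hset : MeasurableSet {z : (Fin n → ℝ) × ℝ | z.1 k ∈ Icc (0 : ℝ) 1} :=
    measurableSet_Icc.preimage (by fun_prop : Measurable fun z : (Fin n → ℝ) × ℝ => z.1 k)
  exact (hnum.aemeasurable.div hBm.comp_snd).indicator hset

theorem isProbabilityMeasure_sampleLaw (hf : IsDensity f) :
    IsProbabilityMeasure (sampleLaw n f) := by
  have := isProbabilityMeasure_law hf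
  unfold sampleLaw
  infer_instance

/-- The risk increases with the exponent, since sample and point together carry a probability
measure. -/
theorem lintegral_rpow_le_risk (hf : IsDensity f) (hb : 0 < b) {q : ℝ} (hq : 0 < q)
    (hqp : q ≤ p) :
    (∫⁻ t in Icc (0 : ℝ) 1, ∫⁻ X, ‖betaEstimator n b X t - f t‖ₑ ^ q ∂(sampleLaw n f)) ^ (1 / q)
      ≤ risk p (betaEstimator n b) f := by
  have := isProbabilityMeasure_sampleLaw (n := n) hf
  have hp : 0 < p := hq.trans_le hqp
  have hI : IsProbabilityMeasure (volume.restrict (Icc (0 : ℝ) 1)) := ⟨by simp⟩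
  set ν := (sampleLaw n f).prod (volume.restrict (Icc (0 : ℝ) 1)) with hν
  set G : (Fin n → ℝ) × ℝ → ℝ := fun z => betaEstimator n b z.1 z.2 - f z.2 with hG
  have hGm : AEMeasurable G ν :=
    (aemeasurable_betaEstimator hb).sub hf.2.1.aemeasurable.comp_snd
  have key : ∀ r : ℝ, 0 < r → eLpNorm G (ENNReal.ofReal r) ν = (∫⁻ X, ∫⁻ t in Icc (0 : ℝ) 1,
      ‖betaEstimator n b X t - f t‖ₑ ^ r ∂volume ∂(sampleLaw n f)) ^ (1 / r) := fun r hr => by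
    rw [eLpNorm_eq_lintegral_rpow_enorm_toReal (by simpa using hr) ENNReal.ofReal_ne_top,
      ENNReal.toReal_ofReal hr.le, lintegral_prod _ (hGm.enorm.pow_const r)]
  rw [← lintegral_lintegral_swap (hGm.enorm.pow_const q), ← key q hq, risk, ← key p hp]
  exact eLpNorm_le_eLpNorm_of_exponent_le (ENNReal.ofReal_le_ofReal hqp) hGm.aestronglyMeasurable

theorem integral_betaEstimator (hf : IsDensity f) (hn : 1 ≤ n) (hb : 0 < b) {t : ℝ}
    (ht : t ∈ Icc (0 : ℝ) 1) :
    ∫ X, betaEstimator n b X t ∂(sampleLaw n f)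
      = ∫ x in Icc (0 : ℝ) 1, betaKernel b t x * f x := by
  have := isProbabilityMeasure_law hf
  have hn' : (n : ℝ) ≠ 0 := by positivity
  have hi : Integrable (betaKernel b t) (law f) := integrable_betaKernel hb ht
  simp only [betaEstimator]
  rw [integral_const_mul, integral_finsetSum _ fun k _ => ?_]
  · simp_rw [sampleLaw, integral_comp_eval (μ := fun _ : Fin n => law f) hi.aestronglyMeasurable]
    rw [Finset.sum_const, Finset.card_univ, Fintype.card_fin, nsmul_eq_mul, integral_law hf,
      ← mul_assoc, one_div, inv_mul_cancel₀ hn', one_mul]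
  · exact (integrable_comp_eval (μ := fun _ : Fin n => law f) hi)

theorem integrable_betaEstimator (hf : IsDensity f) (hb : 0 < b) {t : ℝ}
    (ht : t ∈ Icc (0 : ℝ) 1) :
    Integrable (fun X => betaEstimator n b X t) (sampleLaw n f) := by
  have := isProbabilityMeasure_law hf
  refine Integrable.const_mul (integrable_finsetSum _ fun k _ => ?_) _
  exact integrable_comp_eval (μ := fun _ : Fin n => law f) (integrable_betaKernel hb ht)

/-- Affine densities belong to `Σ(β, L)` for every `L ≥ 0` when `β > 2`, as their derivatives of order
at least two vanish. -/
theorem affine_mem_holderClass (hβ : 2 < β) (hL : 0 ≤ L) {c : ℝ} (hc : |c| ≤ 2) :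
    (fun x : ℝ => 1 + c * (x - 1 / 2)) ∈ holderClass β L := by
  have hsm : ∀ k : ℕ, ContDiff ℝ k fun x : ℝ => 1 + c * (x - 1 / 2) := fun k => by fun_prop
  have hI : UniqueDiffOn ℝ (Icc (0 : ℝ) 1) := uniqueDiffOn_Icc zero_lt_one
  have hcont : Continuous fun x : ℝ => 1 + c * (x - 1 / 2) := (hsm 0).continuous
  obtain ⟨hc1, hc2⟩ := abs_le.1 hc
  refine ⟨⟨fun x hx => ?_, hcont.continuousOn.integrableOn_compact isCompact_Icc, ?_⟩,
    fun k _ => ?_, fun x hx y hy => ?_⟩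
  · nlinarith [hx.1, hx.2]
  · rw [integral_Icc_eq_integral_Ioc, ← intervalIntegral.integral_of_le zero_le_one,
      intervalIntegral.integral_add (by simp)
        ((by fun_prop : Continuous fun x : ℝ => c * (x - 1 / 2)).intervalIntegrable _ _),
      intervalIntegral.integral_const_mul, intervalIntegral.integral_sub (by simp) (by simp)]
    simp
  · exact (hsm (k + 1)).contDiffOn.differentiableOn_iteratedDerivWithin
      (by exact_mod_cast Nat.lt_succ_self k) hI
  · have h2 : 2 ≤ order β := (order_isGreatest (by linarith)).2 (by simpa using hβ)
    obtain ⟨j, hj⟩ := Nat.exists_eq_add_of_le' h2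
    have hz : ∀ z ∈ Icc (0 : ℝ) 1, iteratedDerivWithin (order β)
        (fun x : ℝ => 1 + c * (x - 1 / 2)) (Icc 0 1) z = 0 := fun z hz => by
      rw [iteratedDerivWithin_eq_iteratedDeriv hI (hsm _).contDiffAt hz, hj]
      have hd : deriv (fun x : ℝ => 1 + c * (x - 1 / 2)) = fun _ => c := by
        funext x
        simp
      rw [iteratedDeriv_succ', iteratedDeriv_succ', hd]
      simp
    rw [hz x hx, hz y hy, sub_zero, abs_zero]
    positivity

/-- Lower bound by the bias at the density `1/2 + x`, on the part `t ∈ [3/4, 1]` of the interval. -/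
theorem bias_le_maxRisk (hp : 1 ≤ p) (hβ : 2 < β) (hL : 0 ≤ L) (hn : 1 ≤ n)
    (hb : b ∈ Ioo (0 : ℝ) 1) :
    ENNReal.ofReal (b / 24) ≤ maxRisk p β L (betaEstimator n b) := by
  have hb0 := hb.1
  set f : ℝ → ℝ := fun x => 1 + 1 * (x - 1 / 2) with hf
  have hmem : f ∈ holderClass β L := affine_mem_holderClass hβ hL (by norm_num)
  have hprob := isProbabilityMeasure_sampleLaw (n := n) hmem.1
  refine le_trans ?_ (le_iSup₂ (f := fun g _ => risk p (betaEstimator n b) g) f hmem)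
  refine le_trans ?_ (lintegral_rpow_le_risk hmem.1 hb0 one_pos hp)
  simp only [ENNReal.rpow_one, div_one]
  have hbias : ∀ t ∈ Icc (3 / 4 : ℝ) 1, ENNReal.ofReal (b / 6)
      ≤ ∫⁻ X, ‖betaEstimator n b X t - f t‖ₑ ∂(sampleLaw n f) := fun t ht => by
    have ht' : t ∈ Icc (0 : ℝ) 1 := ⟨by linarith [ht.1], ht.2⟩
    refine le_trans ?_ (enorm_integral_le_lintegral_enorm _)
    rw [integral_sub (integrable_betaEstimator hmem.1 hb0 ht') (integrable_const _),
      integral_betaEstimator hmem.1 hn hb0 ht', integral_const, measureReal_def, measure_univ,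
      ENNReal.toReal_one, one_smul]
    have hm : ∫ x in Icc (0 : ℝ) 1, betaKernel b t x * f x
        = 1 / 2 + (t + b) / (1 + 2 * b) := by
      have h : ∀ x, betaKernel b t x * f x = 1 / 2 * betaKernel b t x + betaKernel b t x * x :=
        fun x => by rw [hf]; ring
      have hi : IntegrableOn (fun x => betaKernel b t x * x) (Icc 0 1) :=
        integrableOn_betaKernel_mul hb0 ht'
          (continuous_id.continuousOn.integrableOn_compact isCompact_Icc)
      simp_rw [h]
      rw [integral_add ((integrable_betaKernel hb0 ht').const_mul _) hi, integral_const_mul,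
        integral_betaKernel hb0 ht', integral_betaKernel_mul_id hb0 ht', mul_one]
    have hd : 1 / 2 + (t + b) / (1 + 2 * b) - f t = -(b * (2 * t - 1) / (1 + 2 * b)) := by
      rw [hf]
      field_simp
      ring
    rw [hm, hd, Real.enorm_eq_ofReal_abs, abs_neg]
    refine ENNReal.ofReal_le_ofReal (le_trans ?_ (le_abs_self _))
    rw [le_div_iff₀ (by positivity)]
    nlinarith [ht.1, hb.2]
  calc ENNReal.ofReal (b / 24)
      = ∫⁻ _t in Icc (3 / 4 : ℝ) 1, ENNReal.ofReal (b / 6) := by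
        rw [setLIntegral_const, Real.volume_Icc, ← ENNReal.ofReal_mul (by positivity)]
        congr 1
        ring
    _ ≤ ∫⁻ t in Icc (3 / 4 : ℝ) 1, ∫⁻ X, ‖betaEstimator n b X t - f t‖ₑ ∂(sampleLaw n f) :=
        setLIntegral_mono' measurableSet_Icc hbias
    _ ≤ ∫⁻ t in Icc (0 : ℝ) 1, ∫⁻ X, ‖betaEstimator n b X t - f t‖ₑ ∂(sampleLaw n f) :=
        lintegral_mono_set (Icc_subset_Icc_left (by norm_num))

theorem lintegral_sq_betaEstimator_sub_one (hf : IsDensity f) (hf1 : ∀ x, f x = 1) (hn : 1 ≤ n)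
    (hb : 0 < b) {t : ℝ} (ht : t ∈ Icc (0 : ℝ) 1) :
    ∫⁻ X, ‖betaEstimator n b X t - f t‖ₑ ^ (2 : ℝ) ∂(sampleLaw n f)
      = ENNReal.ofReal (1 / n * ((∫ x in Icc (0 : ℝ) 1, betaKernel b t x ^ 2) - 1)) := by
  have hprob := isProbabilityMeasure_law hf
  have hprob' := isProbabilityMeasure_sampleLaw (n := n) hf
  have hn' : (n : ℝ) ≠ 0 := by positivity
  have hK : MemLp (betaKernel b t) 2 (law f) :=
    MemLp.of_bound (measurable_betaKernel b t).aestronglyMeasurable _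
      (ae_of_all _ (abs_betaKernel_le hb ht))
  have hKX : ∀ k : Fin n, MemLp (fun X : Fin n → ℝ => betaKernel b t (X k)) 2 (sampleLaw n f) :=
    fun k => MemLp.of_bound ((measurable_betaKernel b t).comp
      (measurable_pi_apply k)).aestronglyMeasurable _
      (ae_of_all _ fun X => abs_betaKernel_le hb ht (X k))
  have hT : MemLp (fun X => betaEstimator n b X t) 2 (sampleLaw n f) :=
    (memLp_finsetSum _ fun k _ => hKX k).const_mul _
  have hmean : ∫ X, betaEstimator n b X t ∂(sampleLaw n f) = f t := by
    rw [integral_betaEstimator hf hn hb ht, hf1]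
    simp_rw [hf1, mul_one]
    exact integral_betaKernel hb ht
  have hvarK : variance (betaKernel b t) (law f)
      = (∫ x in Icc (0 : ℝ) 1, betaKernel b t x ^ 2) - 1 := by
    rw [variance_eq_sub hK, integral_law hf, integral_law hf]
    simp_rw [hf1, mul_one]
    rw [integral_betaKernel hb ht]
    simp
  have hvar : variance (fun X => betaEstimator n b X t) (sampleLaw n f)
      = 1 / n * ((∫ x in Icc (0 : ℝ) 1, betaKernel b t x ^ 2) - 1) := by
    have h := variance_sum_pi (μ := fun _ : Fin n => law f) (X := fun _ => betaKernel b t)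
      fun _ => hK
    have he : (fun X => betaEstimator n b X t)
        = fun X => 1 / (n : ℝ) * (∑ k : Fin n, fun X : Fin n → ℝ => betaKernel b t (X k)) X := by
      funext X
      rw [betaEstimator, Finset.sum_apply]
    rw [he, variance_const_mul, sampleLaw, h, Finset.sum_const, Finset.card_univ,
      Fintype.card_fin, nsmul_eq_mul, hvarK]
    field_simp
  rw [← hvar, ofReal_variance hT, evariance, hmean]
  refine lintegral_congr fun X => ?_
  rw [ENNReal.rpow_two]

/-- Lower bound by the standard deviation at the uniform density. The bandwidth has to be small for
the subtracted squared mean in the variance to be negligible. -/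
theorem variance_le_maxRisk (hp : 2 ≤ p) (hβ : 2 < β) (hL : 0 ≤ L) (hn : 1 ≤ n)
    (hb : 0 < b) (hb' : b ≤ 1 / 64) :
    ENNReal.ofReal (√(1 / (8 * n * √b))) ≤ maxRisk p β L (betaEstimator n b) := by
  set f : ℝ → ℝ := fun x => 1 + 0 * (x - 1 / 2) with hf
  have hmem : f ∈ holderClass β L := affine_mem_holderClass hβ hL (by norm_num)
  have hn' : (0 : ℝ) < n := by exact_mod_cast hn
  have hs0 : 0 < √b := Real.sqrt_pos.2 hb
  have hs1 : √b ≤ 1 / 8 := Real.sqrt_le_iff.2 ⟨by norm_num, by linarith⟩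
  refine le_trans ?_ (le_iSup₂ (f := fun g _ => risk p (betaEstimator n b) g) f hmem)
  refine le_trans ?_ (lintegral_rpow_le_risk hmem.1 hb two_pos hp)
  rw [Real.sqrt_eq_rpow, ← ENNReal.ofReal_rpow_of_nonneg (by positivity) (by positivity)]
  refine ENNReal.rpow_le_rpow ?_ (by positivity)
  calc ENNReal.ofReal (1 / (8 * n * √b))
      = ∫⁻ _t in Icc (0 : ℝ) 1, ENNReal.ofReal (1 / (8 * n * √b)) := by simp
    _ ≤ _ := by
        refine setLIntegral_mono' measurableSet_Icc fun t ht => ?_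
        rw [lintegral_sq_betaEstimator_sub_one hmem.1 (fun x => by simp [hf]) hn hb ht]
        refine ENNReal.ofReal_le_ofReal ?_
        have h := le_integral_betaKernel_sq hb ht
        have h1 : 1 / (8 * √b) ≤ 9 / (32 * √b) - 1 := by
          rw [le_sub_iff_add_le, ← sub_nonneg]
          have : 9 / (32 * √b) - (1 / (8 * √b) + 1) = (5 - 32 * √b) / (32 * √b) := by
            field_simp
            ring
          rw [this]
          exact div_nonneg (by linarith) (by positivity)
        calc 1 / (8 * n * √b) = 1 / n * (1 / (8 * √b)) := by field_simp
          _ ≤ _ := mul_le_mul_of_nonneg_left (by linarith) (by positivity)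

/-- Whatever the bandwidth, bias or standard deviation is of order at least `n ^ (-2/5)`. -/
theorem le_maxRisk_betaEstimator (hp : 2 ≤ p) (hβ : 2 < β) (hL : 0 ≤ L) (hn : 1 ≤ n)
    (hb : b ∈ Ioo (0 : ℝ) 1) :
    ENNReal.ofReal (1 / 1536 * (n : ℝ) ^ (-(2 / 5) : ℝ))
      ≤ maxRisk p β L (betaEstimator n b) := by
  have hn1 : (1 : ℝ) ≤ n := by exact_mod_cast hn
  have hn0 : (0 : ℝ) < n := by linarith
  set r := (n : ℝ) ^ (-(2 / 5) : ℝ) with hr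
  have hr0 : 0 < r := Real.rpow_pos_of_pos hn0 _
  have hr1 : r ≤ 1 := Real.rpow_le_one_of_one_le_of_nonpos hn1 (by norm_num)
  have hbias := bias_le_maxRisk (p := p) (by linarith) hβ hL hn hb
  -- If `b ≥ r / 64` the bias suffices; otherwise `b` is below both `1 / 64` and `r = n ^ (-2/5)`, and
  -- the standard deviation is at least of order `n ^ (-1/2) * r ^ (-1/4) = r`.
  rcases le_or_gt r (64 * b) with h | h
  · exact (ENNReal.ofReal_le_ofReal (by linarith)).trans hbias
  · refine le_trans (ENNReal.ofReal_le_ofReal ?_)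
      (variance_le_maxRisk hp hβ hL hn hb.1 (by linarith))
    refine Real.le_sqrt_of_sq_le ?_
    have hs0 : 0 < √b := Real.sqrt_pos.2 hb.1
    have hsr : √b ≤ √r := Real.sqrt_le_sqrt (by linarith [hb.1])
    have hn5 : r ^ 2 * (n * √r) = 1 := by
      rw [hr, Real.sqrt_eq_rpow, ← Real.rpow_mul hn0.le, ← Real.rpow_natCast, ← Real.rpow_mul hn0.le,
        ← Real.rpow_one_add' hn0.le (by norm_num), ← Real.rpow_add hn0]
      norm_num
    rw [le_div_iff₀ (by positivity)]
    have : r ^ 2 * (n * √b) ≤ r ^ 2 * (n * √r) := by gcongr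
    nlinarith

end Risk

/-! ### Comparison of the rates -/

/-- The rate `n ^ (-β / (2 * β + 1))` for the minimax risk, from `⌈n ^ (1 / (2 * β + 1))⌉` cells. -/
theorem exists_minimaxRisk_le_rpow {p β L : ℝ} (hp : 1 ≤ p) (hβ : 0 < β) (hL : 0 ≤ L) :
    ∃ C : ℝ, 0 < C ∧ ∀ n : ℕ, 1 ≤ n →
      minimaxRisk p β L n ≤ ENNReal.ofReal (C * (n : ℝ) ^ (-(β / (2 * β + 1)))) := by
  obtain ⟨C, hC, h⟩ := exists_minimaxRisk_le (β := β) (L := L) hp hβ hL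
  refine ⟨C * 3, by positivity, fun n hn => ?_⟩
  have hn1 : (1 : ℝ) ≤ n := by exact_mod_cast hn
  have hn0 : (0 : ℝ) < n := by linarith
  set γ := 1 / (2 * β + 1) with hγ
  have hγ0 : 0 < γ := by positivity
  have hγ1 : γ ≤ 1 := by
    rw [hγ, div_le_one (by positivity)]
    linarith
  have hx1 : 1 ≤ (n : ℝ) ^ γ := Real.one_le_rpow hn1 hγ0.le
  have hN0 : 0 < ⌈(n : ℝ) ^ γ⌉₊ := Nat.ceil_pos.2 (by linarith)
  have hNn : ⌈(n : ℝ) ^ γ⌉₊ ≤ n := Nat.ceil_le.2 (Real.rpow_le_self_of_one_le hn1 hγ1)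
  have hlow : (n : ℝ) ^ γ ≤ ⌈(n : ℝ) ^ γ⌉₊ := Nat.le_ceil _
  have hup : (⌈(n : ℝ) ^ γ⌉₊ : ℝ) ≤ 4 * (n : ℝ) ^ γ := by
    linarith [Nat.ceil_lt_add_one (by positivity : 0 ≤ (n : ℝ) ^ γ)]
  set N := ⌈(n : ℝ) ^ γ⌉₊
  refine (h n N hN0 hNn).trans (ENNReal.ofReal_le_ofReal ?_)
  rw [mul_assoc]
  refine mul_le_mul_of_nonneg_left ?_ hC.le
  have h1 : (N : ℝ) ^ (-β) ≤ (n : ℝ) ^ (-(β / (2 * β + 1))) := by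
    calc (N : ℝ) ^ (-β) ≤ ((n : ℝ) ^ γ) ^ (-β) :=
          Real.rpow_le_rpow_of_nonpos (by positivity) hlow (by linarith)
      _ = _ := by
          rw [← Real.rpow_mul hn0.le, hγ]
          congr 1
          ring
  have h2 : √((N : ℝ) / n) ≤ 2 * (n : ℝ) ^ (-(β / (2 * β + 1))) := by
    refine Real.sqrt_le_iff.2 ⟨by positivity, ?_⟩
    have he : ((n : ℝ) ^ (-(β / (2 * β + 1)))) ^ 2 = (n : ℝ) ^ γ / n := by
      rw [← Real.rpow_natCast, ← Real.rpow_mul hn0.le, ← Real.rpow_sub_one hn0.ne', hγ]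
      congr 1
      field_simp
      push_cast
      ring
    rw [mul_pow, he, ← mul_div_assoc]
    gcongr
    linarith
  linarith

end BetaKernel

theorem theorem2 (p β L : ℝ) (hp : 2 ≤ p) (hβ : 2 < β) (hL : 0 < L) :
    (∃ c : ℝ, 0 < c ∧ ∀ n : ℕ, 1 ≤ n → ∀ b ∈ Set.Ioo (0 : ℝ) 1,
      ENNReal.ofReal (c * (n : ℝ) ^ (-(2 / 5) : ℝ))
        ≤ BetaKernel.maxRisk p β L (BetaKernel.betaEstimator n b)) ∧
    ∀ b : ℕ → ℝ, (∀ n, b n ∈ Set.Ioo (0 : ℝ) 1) →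
      Filter.liminf
        (fun n : ℕ => BetaKernel.maxRisk p β L (BetaKernel.betaEstimator n (b n))
          / BetaKernel.minimaxRisk p β L n) Filter.atTop = ⊤ := by
  have hlow := fun (n : ℕ) (hn : 1 ≤ n) (b : ℝ) (hb : b ∈ Set.Ioo (0 : ℝ) 1) =>
    BetaKernel.le_maxRisk_betaEstimator hp hβ hL.le hn hb
  refine ⟨⟨1 / 1536, by norm_num, hlow⟩, fun b hb => Tendsto.liminf_eq ?_⟩
  obtain ⟨C, hC, hup⟩ := BetaKernel.exists_minimaxRisk_le_rpow (p := p) (β := β) (L := L)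
    (by linarith) (by linarith) hL.le
  set e := β / (2 * β + 1) - 2 / 5 with he
  have he0 : 0 < e := by
    rw [he, sub_pos, div_lt_div_iff₀ (by norm_num) (by linarith)]
    linarith
  have hlim : Tendsto (fun n : ℕ => ENNReal.ofReal (1 / 1536 / C * (n : ℝ) ^ e)) atTop
      (nhds ⊤) :=
    ENNReal.tendsto_ofReal_atTop.comp
      (((tendsto_rpow_atTop he0).comp tendsto_natCast_atTop_atTop).const_mul_atTop
        (by positivity))
  refine tendsto_nhds_top_mono hlim ?_
  filter_upwards [eventually_ge_atTop 1] with n hn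
  have hn0 : (0 : ℝ) < n := by exact_mod_cast hn
  refine le_trans (le_of_eq ?_) (ENNReal.div_le_div (hlow n hn (b n) (hb n)) (hup n hn))
  rw [← ENNReal.ofReal_div_of_pos (by positivity)]
  congr 1
  rw [mul_div_mul_comm, ← Real.rpow_sub hn0, he]
  congr 2
  ring
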